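/- **Model.** There are $n\ge 0$ consumers $N=\{1,\dots,n\}$ and $m\ge 1$ suppliers $V=\{1,\dots,m\}$. A menu profile is $S=(S_1,\dots,S_n)$ with $S_i\subseteq V$. In the first stage every consumer $i$ independently chooses $j\in S_i$ with probability $p_{ij}(S_i)=v_{ij}/(1+\sum_{k\in S_i}v_{ik})$, or the outside option with probability $1/(1+\sum_{k\in S_i}v_{ik})$ (multinomial logit model, outside score normalized to $1$). Let $C_j$ be the set of consumers that chose $j$. In the second stage every supplier $j$ independently chooses each $i\in C_j$ with probability $q_{ji}(C_j)=1/(|C_j|+u_{j0})$, and nobody with the remaining probability (Uniform model). A supplier $j$ that chooses a consumer is matched and yields revenue $r_j\ge 0$; $\mathbf M_S$ is the total revenue. The problem is to maximize $\mathbb E[\mathbf M_S]$ over all feasible menu profiles, either (i) all menu profiles, or (ii) those with $|S_i|\le K_i$ for all $i$, where $K_i\ge 1$ are given integers; $\mathrm{OPT}$ is the optimal value. **Algorithm 1.** Let $Q_j(A)=\sum_{i\in A}q_{ji}(A)$, for $A\subseteq N\times V$ let $A_j=\{i:(i,j)\in A\}$ and $f(A)=\sum_{j\in V} r_jQ_j(A_j)$,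 and let $F$ be the multilinear extension of $f$ to $[0,1]^{N\times V}$. Let $\mathcal P$ be the convex hull of the indicator vectors of the sets $A\subseteq N\times V$ that contain at most one pair $(i,j)$ for each $i\in N$. *Continuous greedy* with step size $\delta=1/T$: start at $y_0=0$, and for $t=0,\dots,T-1$ set $y_{t+1}=y_t+\delta z_t$, where $z_t$ maximizes $\langle\nabla F(y_t),z\rangle$ over $z\in\mathcal P$ (ties broken arbitrarily among maximizers with $\sum_j z_{ij}=1$ for all $i$). *Rounding*: assign each consumer $i$ independently to supplier $j$ with probability $(y_T)_{ij}$; this gives a partition $A^g_1,\dots,A^g_m$ of $N$. *Output*: $S_i=\{j\in V: i\in A^g_j\}$ for all $i\in N$. **Claim.** Algorithm 1 is a randomized polynomial-time algorithm that achieves a $(1-e^{-1})/2\approx 0.316$ approximation factor under the MNL-Uniform model with scores $v_{ij}\ge 1$ and $u_{j0}\ge 0$. That is, there is a constant $b$ such that for all such instances the following hold. 1. For every $T\ge b(n+m+1)^b$ and every tie-breaking, the random menu profile $S$ output by Algorithm 1 is always feasible and satisfies $$\mathbb E[\mathbf M_S]\ \ge\ \frac{1-e^{-1}}{2}\cdot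 \mathrm{OPT},$$ where the expectation is also over the randomness of the algorithm, both for the unconstrained problem (i) and for the problem (ii) subject to cardinality constraints. 2. There are a constant $c$ and one randomized program (for a random access machine with unit-cost arithmetic on real numbers and unit-cost uniform random draws from $\{0,\dots,k-1\}$) that, given $n$, $m$, $(r_j)_j$ and $(u_{j0})_j$, always stops after at most $c(n+m+1)^c$ steps and whose output has exactly the law of the output of Algorithm 1 for some $T\ge b(n+m+1)^b$ and some tie-breaking. -/

import Mathlib

open scoped BigOperators

noncomputable section

namespace SeqMatch

/-! ### Two-sided sequential matching

Consumers are `Fin n`, suppliers are `Fin m`.  An agent facing a menu of options in `α` ends up with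
an element of `Option α`, where `none` is the outside option. -/

/-- A system of choice probabilities: `p x S` is the probability of ending up with `x` when the menu
is `S`. -/
abbrev ChoiceSystem (α : Type) : Type := Option α → Finset α → ℝ

/-- The demand function: the probability that an element of the menu is chosen. -/
def demand {α : Type} (p : ChoiceSystem α) (S : Finset α) : ℝ := ∑ x ∈ S, p (some x) S

/-- A menu profile (assortment family): one set of suppliers for each consumer. -/
abbrev MenuProfile (n m : ℕ) : Type := Fin n → Finset (Fin m)

/-- The consumers who chose supplier `j` in the first stage, when `c` is the profile of choices. -/
def choosers {n m : ℕ} (c : Fin n → Option (Fin m)) (j : Fin m) : Finset (Fin n) :=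
  Finset.univ.filter fun i => c i = some j

/-- The revenue of the matching if the consumers chose `c` in the first stage and the suppliers
chose `d` in the second stage: `j` is matched when it selects a consumer who selected it. -/
def matchingRevenue {n m : ℕ} (r : Fin m → ℝ) (c : Fin n → Option (Fin m))
    (d : Fin m → Option (Fin n)) : ℝ :=
  ∑ j, if ∃ i, c i = some j ∧ d j = some i then r j else 0

/-- The expected revenue of the matching for the menu profile `S`.  In the first stage the consumers
choose independently from their menus; in the second stage every supplier `j` chooses,
independently, from the set of consumers who chose `j`. -/
def expectedRevenue {n m : ℕ} (p : Fin n → ChoiceSystem (Fin m)) (q : Fin m → ChoiceSystem (Fin n))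
    (r : Fin m → ℝ) (S : MenuProfile n m) : ℝ :=
  ∑ c : Fin n → Option (Fin m), (∏ i, p i (c i) (S i)) *
    ∑ d : Fin m → Option (Fin n), (∏ j, q j (d j) (choosers c j)) * matchingRevenue r c d

/-! ### The MNL-Uniform model -/

/-- An instance of the MNL-Uniform model: scores `v i j` of the suppliers for the consumers, scores
`u j` of the outside option for the suppliers, revenues `r j`.  The score of the outside option for
the consumers is normalized to `1`. -/
structure MNLUniform (n m : ℕ) where
  v : Fin n → Fin m → ℝ
  u : Fin m → ℝ
  r : Fin m → ℝ
  v_pos : ∀ i j, 0 < v i j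
  u_nonneg : ∀ j, 0 ≤ u j
  r_nonneg : ∀ j, 0 ≤ r j

/-- The multinomial logit model with scores `w` (outside option: score `1`). -/
def mnlChoice {α : Type} [DecidableEq α] (w : α → ℝ) : ChoiceSystem α
  | none, S => 1 / (1 + ∑ k ∈ S, w k)
  | some j, S => if j ∈ S then w j / (1 + ∑ k ∈ S, w k) else 0

/-- The uniform model with score `u₀` of the outside option.  From an empty menu the outside option
is chosen with certainty (this matters only if `u₀ = 0`). -/
def uniformChoice {α : Type} [DecidableEq α] (u₀ : ℝ) : ChoiceSystem α
  | none, C => if C = ∅ then 1 else u₀ / ((C.card : ℝ) + u₀)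
  | some i, C => if i ∈ C then 1 / ((C.card : ℝ) + u₀) else 0

namespace MNLUniform

variable {n m : ℕ}

/-- The choice probabilities of the consumers. -/
def consumerChoice (I : MNLUniform n m) (i : Fin n) : ChoiceSystem (Fin m) := mnlChoice (I.v i)

/-- The choice probabilities of the suppliers. -/
def supplierChoice (I : MNLUniform n m) (j : Fin m) : ChoiceSystem (Fin n) := uniformChoice (I.u j)

/-- The objective: the expected revenue of a menu profile. -/
def revenue (I : MNLUniform n m) (S : MenuProfile n m) : ℝ :=
  expectedRevenue I.consumerChoice I.supplierChoice I.r S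

/-- The optimal value over a set of feasible menu profiles (a maximum, since there are finitely many
menu profiles). -/
def opt (I : MNLUniform n m) (feasible : Set (MenuProfile n m)) : ℝ := sSup (I.revenue '' feasible)

end MNLUniform

/-- The menu profiles that satisfy the cardinality constraints with budgets `K`. -/
def cardFeasible {n m : ℕ} (K : Fin n → ℕ) : Set (MenuProfile n m) :=
  {S | ∀ i, (S i).card ≤ K i}

/-! ### Submodular welfare and the continuous greedy algorithm

Items are the consumers, players are the suppliers; the ground set is the set of pairs
`(consumer, supplier)`. -/

/-- The part `A_j` of a set `A` of pairs. -/
def part {n m : ℕ} (A : Finset (Fin n × Fin m)) (j : Fin m) : Finset (Fin n) :=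
  Finset.univ.filter fun i => (i, j) ∈ A

/-- The welfare objective: the sum over the suppliers of `r_j Q_j(A_j)`. -/
def MNLUniform.welfare {n m : ℕ} (I : MNLUniform n m) (A : Finset (Fin n × Fin m)) : ℝ :=
  ∑ j, I.r j * demand (I.supplierChoice j) (part A j)

/-- The multilinear extension of a set function. -/
def multilinearExtension {ε : Type} [Fintype ε] [DecidableEq ε] (f : Finset ε → ℝ) (y : ε → ℝ) : ℝ :=
  ∑ A : Finset ε, f A * (∏ e ∈ A, y e) * ∏ e ∈ Aᶜ, (1 - y e)

/-- The partition constraints: every consumer is assigned to at most one supplier. -/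
def partitionConstraint (n m : ℕ) : Set (Finset (Fin n × Fin m)) :=
  {A | ∀ i : Fin n, (A.filter fun e => e.1 = i).card ≤ 1}

/-- The convex hull of the indicator vectors of the sets in the partition constraints. -/
def partitionPolytope (n m : ℕ) : Set (Fin n × Fin m → ℝ) :=
  convexHull ℝ ((fun A : Finset (Fin n × Fin m) => fun e => if e ∈ A then (1 : ℝ) else 0) ''
    partitionConstraint n m)

/-- `y 0, …, y T` are the iterates of the continuous greedy algorithm with step size `1 / T` for the
set function `f`: start at `0` and repeatedly move in a direction `z` of the polytope that maximizes
the inner product with the gradient of the multilinear extension.  Ties are broken arbitrarily,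
except that every item is completely distributed (so that the end point can be rounded to a
partition of all items; for monotone `f` such a maximizer always exists). -/
structure IsContinuousGreedyRun {n m : ℕ} (f : Finset (Fin n × Fin m) → ℝ) (T : ℕ)
    (y : ℕ → Fin n × Fin m → ℝ) : Prop where
  start : y 0 = 0
  step : ∀ t < T, ∃ z ∈ partitionPolytope n m,
    IsMaxOn (fun w => fderiv ℝ (multilinearExtension f) (y t) w) (partitionPolytope n m) z ∧
    (∀ i, ∑ j, z (i, j) = 1) ∧
    y (t + 1) = y t + (1 / (T : ℝ)) • z

/-- The partition in which consumer `i` is assigned to supplier `a i`. -/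
def partitionOf {n m : ℕ} (a : Fin n → Fin m) (j : Fin m) : Finset (Fin n) :=
  Finset.univ.filter fun i => a i = j

/-- The menu profile determined by a partition: supplier `j` is in the menu of the consumers in its
part. -/
def menusOf {n m : ℕ} (P : Fin m → Finset (Fin n)) : MenuProfile n m :=
  fun i => Finset.univ.filter fun j => i ∈ P j

/-- The law of the output of the algorithm for easy-to-match consumers, when `y` is the end point of
the continuous greedy algorithm: `y` is rounded by assigning the consumers independently, consumer
`i` to supplier `j` with probability `y (i, j)`, and the menu profile determined by the resulting
partition is returned. -/
def algorithmLaw {n m : ℕ} (y : Fin n × Fin m → ℝ) (S : MenuProfile n m) : ℝ :=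
  ∑ a : Fin n → Fin m, if menusOf (partitionOf a) = S then ∏ i, y (i, a i) else 0

/-! ### Randomized programs with a step count

A random access machine with unit-cost arithmetic on real numbers.  It has registers and
two-dimensional arrays for natural numbers (used for indexing and counting) and for real numbers. -/

/-- The memory, together with the number of steps made so far. -/
structure Memory where
  nreg : ℕ → ℕ
  rreg : ℕ → ℝ
  narr : ℕ → ℕ → ℕ → ℕ
  rarr : ℕ → ℕ → ℕ → ℝ
  time : ℕ

namespace Memory

/-- Count one step. -/
def tick (s : Memory) : Memory := { s with time := s.time + 1 }

/-- Write `k` into the natural register `x`. -/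
def setN (s : Memory) (x k : ℕ) : Memory := { s with nreg := Function.update s.nreg x k }

/-- Write `k` into the real register `x`. -/
def setR (s : Memory) (x : ℕ) (k : ℝ) : Memory := { s with rreg := Function.update s.rreg x k }

/-- Write `k` at position `(i, j)` of the natural array `a`. -/
def storeN (s : Memory) (a i j k : ℕ) : Memory :=
  { s with narr := Function.update s.narr a
                      (Function.update (s.narr a) i (Function.update (s.narr a i) j k)) }

/-- Write `k` at position `(i, j)` of the real array `a`. -/
def storeR (s : Memory) (a i j : ℕ) (k : ℝ) : Memory :=
  { s with rarr := Function.update s.rarr a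
                      (Function.update (s.rarr a) i (Function.update (s.rarr a i) j k)) }

end Memory

/-- The arithmetic operations on real registers. -/
inductive ArithOp
  | add
  | sub
  | mul
  | div

/-- The meaning of the arithmetic operations. -/
def ArithOp.eval : ArithOp → ℝ → ℝ → ℝ
  | .add, x, y => x + y
  | .sub, x, y => x - y
  | .mul, x, y => x * y
  | .div, x, y => x / y

/-- Programs.  All arguments of type `ℕ` are names of registers or arrays, except for the value `k`
of the constants. -/
inductive Program
  /-- `x := k` for a natural register -/
  | nconst (x k : ℕ)
  /-- `x := y + z` for natural registers -/
  | nadd (x y z : ℕ)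
  /-- `x := a[i, j]` for a natural array `a`, with `i`, `j` natural registers -/
  | nload (x a i j : ℕ)
  /-- `a[i, j] := x` for a natural array `a` -/
  | nstore (a i j x : ℕ)
  /-- `x := k` for a real register; only natural numbers are constants -/
  | rconst (x k : ℕ)
  /-- `x := y` for a real register `x` and a natural register `y` -/
  | rcast (x y : ℕ)
  /-- `x := y op z` for real registers -/
  | rop (op : ArithOp) (x y z : ℕ)
  /-- `x := a[i, j]` for a real array `a` -/
  | rload (x a i j : ℕ)
  /-- `a[i, j] := x` for a real array `a` -/
  | rstore (a i j x : ℕ)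
  /-- `x :=` a fresh uniformly random element of `{0, …, y - 1}` (or `0` if `y = 0`) -/
  | rand (x y : ℕ)
  /-- sequential composition -/
  | seq (P Q : Program)
  /-- if `x < y` (natural registers) then `P` else `Q` -/
  | ifN (x y : ℕ) (P Q : Program)
  /-- if `x < y` (real registers) then `P` else `Q` -/
  | ifR (x y : ℕ) (P Q : Program)
  /-- for `x = 0, 1, …, y - 1` do `P`, where `y` is read once, at the beginning -/
  | loop (x y : ℕ) (P : Program)

/-- The law of the memory after running a program.  Every elementary instruction, every test, every
entry into a loop and every iteration of a loop counts as one step. -/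
def Program.exec : Program → Memory → PMF Memory
  | .nconst x k, s => PMF.pure (s.tick.setN x k)
  | .nadd x y z, s => PMF.pure (s.tick.setN x (s.nreg y + s.nreg z))
  | .nload x a i j, s => PMF.pure (s.tick.setN x (s.narr a (s.nreg i) (s.nreg j)))
  | .nstore a i j x, s => PMF.pure (s.tick.storeN a (s.nreg i) (s.nreg j) (s.nreg x))
  | .rconst x k, s => PMF.pure (s.tick.setR x (k : ℝ))
  | .rcast x y, s => PMF.pure (s.tick.setR x (s.nreg y : ℝ))
  | .rop op x y z, s => PMF.pure (s.tick.setR x (op.eval (s.rreg y) (s.rreg z)))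
  | .rload x a i j, s => PMF.pure (s.tick.setR x (s.rarr a (s.nreg i) (s.nreg j)))
  | .rstore a i j x, s => PMF.pure (s.tick.storeR a (s.nreg i) (s.nreg j) (s.rreg x))
  | .rand x y, s =>
      match s.nreg y with
      | 0 => PMF.pure (s.tick.setN x 0)
      | k + 1 => (PMF.uniformOfFintype (Fin (k + 1))).map fun d => s.tick.setN x (d : ℕ)
  | .seq P Q, s => (P.exec s).bind Q.exec
  | .ifN x y P Q, s => if s.nreg x < s.nreg y then P.exec s.tick else Q.exec s.tick
  | .ifR x y P Q, s => if s.rreg x < s.rreg y then P.exec s.tick else Q.exec s.tick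
  | .loop x y P, s =>
      (List.range (s.nreg y)).foldl
        (fun law k => law.bind fun s' => P.exec (s'.tick.setN x k)) (PMF.pure s.tick)

/-- The initial memory: `n` and `m` in the natural registers `0` and `1`, the revenues in the real
array `0`, the parameters of the demand functions (the outside scores of the suppliers) in the real
array `1`, everything else zero. -/
def MNLUniform.input {n m : ℕ} (I : MNLUniform n m) : Memory where
  nreg x := if x = 0 then n else if x = 1 then m else 0
  rreg _ := 0
  narr _ _ _ := 0
  rarr a i j :=
    if h : i < m ∧ j = 0 then
      (if a = 0 then I.r ⟨i, h.1⟩ else if a = 1 then I.u ⟨i, h.1⟩ else 0)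
    else 0
  time := 0

/-- The menu profile that a program outputs, as a 0-1 table in the natural array `0`. -/
def Memory.output (n m : ℕ) (s : Memory) : MenuProfile n m :=
  fun i => Finset.univ.filter fun j : Fin m => s.narr 0 (i : ℕ) (j : ℕ) ≠ 0

/-- The law `ℓ` on menu profiles achieves the factor `α` for the maximization of the expected revenue
over a set of feasible menu profiles: its outcomes are feasible, and its expected objective value is
at least `α` times the optimal value. -/
def MNLUniform.Achieves {n m : ℕ} (I : MNLUniform n m) (α : ℝ) (feasible : Set (MenuProfile n m))
    (ℓ : MenuProfile n m → ℝ) : Prop :=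
  (∀ S, ℓ S ≠ 0 → S ∈ feasible) ∧ α * I.opt feasible ≤ ∑ S, ℓ S * I.revenue S

end SeqMatch

end

open scoped BigOperators

noncomputable section

namespace SeqMatch

/-! Write g_j(k) = k / (k + u_j), and let W be the largest welfare ∑_j r_j g_j(|A_j|) of an
assignment of all consumers to suppliers. Then OPT ≤ W (`MNLUniform.revenue_le`): given the
first-stage choices, the expected revenue is ∑_j r_j g_j(|C_j|), and g_j is monotone, so every
realized profile of choices is dominated by an assignment. Conversely, the singleton menus of an
assignment keep at least half of its welfare (`MNLUniform.half_assignmentValue_le`): scores at least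
1 make every consumer accept with probability at least 1/2, and for C ⊆ A the bound |C|/(|C|+u) ≥
|C|/(|A|+u) is linear in the acceptances. Singletons respect every cardinality constraint with K_i ≥
1, so both problems reduce to a continuous greedy run that reaches (1 - 1/e) W. Independent rounding
then costs nothing, because welfare is separable over the suppliers
(`MNLUniform.sum_prod_mul_assignmentValue`).

The difficulty is that discretization normally costs an error term, while the claimed factor has
none. The loss is won back by `MNLUniform.assignmentValue_le`. Suppliers see only cardinalities, so
an optimum with part sizes k_j may be compared through the fractional point whose rows all equal
(k_j/n)_j. That point also puts weight on pairs already present, which gives a surplus (1/n)⟨y,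
∇F(y)⟩ over the usual bound W ≤ F(y) + max ⟨∇F(y), z⟩. One step (`MNLUniform.greedy_step`) therefore
gains δ(W - F + surplus) - δ²n²W. During the first T/(2n) steps the partial derivatives stay above
half of their initial values, so the surplus is at least F/(2n). It adds up to a constant times
W/n³, more than the total error of order n²W/T once T ≥ 1000 n⁵ (`one_sub_exp_le_of_recursion`).

The same symmetry gives an exact polynomial-time program. From a point with identical rows, one
supplier is best for all consumers, so the rows remain identical
(`MNLUniform.isContinuousGreedyRun_point`). The partial derivatives are binomial expectations,
computed by de Casteljau's scheme. The end point records how often each supplier was chosen, so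
drawing a uniformly random step for each consumer rounds it with exactly the right law
(`algorithmLaw_eq_sum`). The program is verified by Hoare-style rules together with a frame and a
cost bound read off its syntax. -/

/-! ### The multilinear extension -/

section Multilinear

variable {ε : Type} [DecidableEq ε]

/-- The expectation of `φ` at the random subset of `C` that contains every `e ∈ C` independently with
probability `y e`. -/
def subsetSum (C : Finset ε) (φ : Finset ε → ℝ) (y : ε → ℝ) : ℝ :=
  ∑ A ∈ C.powerset, φ A * (∏ e ∈ A, y e) * ∏ e ∈ C \ A, (1 - y e)

theorem subsetSum_insert {e : ε} {C : Finset ε} (he : e ∉ C) (φ : Finset ε → ℝ) (y : ε → ℝ) :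
    subsetSum (insert e C) φ y =
      y e * subsetSum C (fun A => φ (insert e A)) y + (1 - y e) * subsetSum C φ y := by
  unfold subsetSum
  rw [Finset.sum_powerset_insert he, add_comm, Finset.mul_sum, Finset.mul_sum]
  congr 1
  · refine Finset.sum_congr rfl fun A hA => ?_
    have heA : e ∉ A := fun h => he (Finset.mem_powerset.1 hA h)
    rw [Finset.prod_insert heA, Finset.insert_sdiff_insert, Finset.sdiff_insert_of_notMem he]
    ring
  · refine Finset.sum_congr rfl fun A hA => ?_
    have heA : e ∉ A := fun h => he (Finset.mem_powerset.1 hA h)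
    rw [Finset.insert_sdiff_of_notMem _ heA, Finset.prod_insert (by simp [he])]
    ring

theorem subsetSum_congr {C : Finset ε} {φ ψ : Finset ε → ℝ} {y x : ε → ℝ}
    (hφ : ∀ A ⊆ C, φ A = ψ A) (hy : ∀ e ∈ C, y e = x e) : subsetSum C φ y = subsetSum C ψ x := by
  unfold subsetSum
  refine Finset.sum_congr rfl fun A hA => ?_
  rw [Finset.mem_powerset] at hA
  rw [hφ A hA, Finset.prod_congr rfl fun e he => hy e (hA he),
    Finset.prod_congr (s₁ := C \ A) rfl fun e he => by
      rw [hy e (Finset.mem_sdiff.1 he).1]]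

variable [Fintype ε]

theorem multilinearExtension_eq_subsetSum (φ : Finset ε → ℝ) (y : ε → ℝ) :
    multilinearExtension φ y = subsetSum Finset.univ φ y := by
  simp [multilinearExtension, subsetSum, Finset.compl_eq_univ_sdiff]

theorem multilinearExtension_eq_erase (e : ε) (φ : Finset ε → ℝ) (y : ε → ℝ) :
    multilinearExtension φ y =
      y e * subsetSum (Finset.univ.erase e) (fun A => φ (insert e A)) y +
        (1 - y e) * subsetSum (Finset.univ.erase e) φ y := by
  rw [multilinearExtension_eq_subsetSum, ← subsetSum_insert (Finset.notMem_erase _ _),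
    Finset.insert_erase (Finset.mem_univ e)]

theorem multilinearExtension_mono {φ ψ : Finset ε → ℝ} {y : ε → ℝ} (h : ∀ A, φ A ≤ ψ A)
    (h0 : ∀ e, 0 ≤ y e) (h1 : ∀ e, y e ≤ 1) :
    multilinearExtension φ y ≤ multilinearExtension ψ y := by
  unfold multilinearExtension
  refine Finset.sum_le_sum fun A _ => ?_
  have h2 : 0 ≤ ∏ e ∈ A, y e := Finset.prod_nonneg fun e _ => h0 e
  have h3 : 0 ≤ ∏ e ∈ Aᶜ, (1 - y e) := Finset.prod_nonneg fun e _ => sub_nonneg.2 (h1 e)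
  gcongr
  exact h A

theorem multilinearExtension_sum {ι : Type} (s : Finset ι) (φ : ι → Finset ε → ℝ) (y : ε → ℝ) :
    multilinearExtension (fun A => ∑ i ∈ s, φ i A) y = ∑ i ∈ s, multilinearExtension (φ i) y := by
  unfold multilinearExtension
  rw [Finset.sum_comm]
  simp only [Finset.sum_mul]

theorem multilinearExtension_add (φ ψ : Finset ε → ℝ) (y : ε → ℝ) :
    multilinearExtension (fun A => φ A + ψ A) y =
      multilinearExtension φ y + multilinearExtension ψ y := by
  simp [multilinearExtension, add_mul, Finset.sum_add_distrib]

theorem multilinearExtension_sub (φ ψ : Finset ε → ℝ) (y : ε → ℝ) :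
    multilinearExtension (fun A => φ A - ψ A) y =
      multilinearExtension φ y - multilinearExtension ψ y := by
  simp [multilinearExtension, sub_mul, Finset.sum_sub_distrib]

theorem multilinearExtension_const_mul (c : ℝ) (φ : Finset ε → ℝ) (y : ε → ℝ) :
    multilinearExtension (fun A => c * φ A) y = c * multilinearExtension φ y := by
  simp [multilinearExtension, mul_assoc, Finset.mul_sum]

theorem multilinearExtension_const (c : ℝ) (y : ε → ℝ) :
    multilinearExtension (fun _ => c) y = c := by
  have h := Finset.prod_add y (fun e => 1 - y e) Finset.univ
  simp only [add_sub_cancel, Finset.prod_const_one] at h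
  simp only [multilinearExtension, mul_assoc, ← Finset.mul_sum, Finset.compl_eq_univ_sdiff]
  rw [Finset.powerset_univ] at h
  rw [← h, mul_one]

/-- The marginal value of `e`. -/
def slope (φ : Finset ε → ℝ) (e : ε) (A : Finset ε) : ℝ := φ (insert e A) - φ (A.erase e)

/-- `slope φ e` ignores whether `e` belongs to its argument, so the coordinate `y e` averages out.
What remains is the difference between the faces `y e = 1` and `y e = 0`, that is, the partial
derivative. -/
theorem multilinearExtension_slope (φ : Finset ε → ℝ) (e : ε) (y : ε → ℝ) :
    multilinearExtension (slope φ e) y =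
      subsetSum (Finset.univ.erase e) (fun A => φ (insert e A)) y -
        subsetSum (Finset.univ.erase e) φ y := by
  have h : ∀ ψ : Finset ε → ℝ, (∀ A, ψ (insert e A) = ψ (A.erase e)) →
      multilinearExtension ψ y = subsetSum (Finset.univ.erase e) ψ y := by
    intro ψ hψ
    rw [multilinearExtension_eq_erase e,
      subsetSum_congr (φ := fun A => ψ (insert e A)) (ψ := ψ) (x := y) _ fun _ _ => rfl]
    · ring
    · intro A hA
      have : e ∉ A := fun h => by simpa using hA h
      rw [hψ, Finset.erase_eq_of_notMem this]
  have h1 := h (fun A => φ (insert e A)) fun A => by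
    congr 1
    ext d
    by_cases hd : d = e <;> simp [hd]
  have h2 := h (fun A => φ (A.erase e)) (by simp)
  unfold slope
  rw [multilinearExtension_sub, h1, h2]
  congr 1
  refine subsetSum_congr (fun A hA => ?_) fun _ _ => rfl
  have : e ∉ A := fun h => by simpa using hA h
  simp only [Finset.erase_eq_of_notMem this]

/-- The event `e ∈ A` is independent of `slope φ e A` and has probability `y e`. This makes ⟨y,
∇F(y)⟩ an expectation, so that inequalities about it can be proved set by set. -/
theorem mul_multilinearExtension_slope (φ : Finset ε → ℝ) (e : ε) (y : ε → ℝ) :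
    y e * multilinearExtension (slope φ e) y =
      multilinearExtension (fun A => if e ∈ A then slope φ e A else 0) y := by
  rw [multilinearExtension_eq_erase e (fun A => if e ∈ A then slope φ e A else 0),
    multilinearExtension_slope]
  have h1 : subsetSum (Finset.univ.erase e) (fun A => if e ∈ A then slope φ e A else 0) y = 0 := by
    refine Finset.sum_eq_zero fun A hA => ?_
    have : e ∉ A := fun h => by simpa using (Finset.mem_powerset.1 hA) h
    simp [this]
  have h2 : subsetSum (Finset.univ.erase e)
      (fun A => if e ∈ insert e A then slope φ e (insert e A) else 0) y =
      subsetSum (Finset.univ.erase e) (fun A => φ (insert e A)) y -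
        subsetSum (Finset.univ.erase e) φ y := by
    unfold subsetSum
    rw [← Finset.sum_sub_distrib]
    refine Finset.sum_congr rfl fun A hA => ?_
    have : e ∉ A := fun h => by simpa using (Finset.mem_powerset.1 hA) h
    simp [slope, this, sub_mul]
  rw [h1, h2]
  ring

theorem multilinearExtension_mem (e : ε) (y : ε → ℝ) :
    multilinearExtension (fun A => if e ∈ A then 1 else 0) y = y e := by
  have h := mul_multilinearExtension_slope (fun A : Finset ε => if e ∈ A then (1 : ℝ) else 0) e y
  have hs : slope (fun A : Finset ε => if e ∈ A then (1 : ℝ) else 0) e = fun _ => 1 := by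
    funext A
    simp [slope]
  rw [hs, multilinearExtension_const, mul_one] at h
  exact h.symm

theorem multilinearExtension_add_smul_single (φ : Finset ε → ℝ) (e : ε) (y : ε → ℝ) (s : ℝ) :
    multilinearExtension φ (y + s • Pi.single e 1) =
      multilinearExtension φ y + s * multilinearExtension (slope φ e) y := by
  have h : ∀ ψ : Finset ε → ℝ, subsetSum (Finset.univ.erase e) ψ (y + s • Pi.single e 1) =
      subsetSum (Finset.univ.erase e) ψ y := fun ψ =>
    subsetSum_congr (fun _ _ => rfl) fun d hd => by
      simp [Pi.single_eq_of_ne (Finset.ne_of_mem_erase hd)]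
  rw [multilinearExtension_eq_erase e, multilinearExtension_eq_erase e φ y,
    multilinearExtension_slope, h, h]
  simp
  ring

theorem differentiable_multilinearExtension (φ : Finset ε → ℝ) :
    Differentiable ℝ (multilinearExtension φ) := by
  unfold multilinearExtension
  fun_prop

theorem fderiv_multilinearExtension (φ : Finset ε → ℝ) (y w : ε → ℝ) :
    fderiv ℝ (multilinearExtension φ) y w = ∑ e, w e * multilinearExtension (slope φ e) y := by
  have key : ∀ e : ε, fderiv ℝ (multilinearExtension φ) y (Pi.single e 1) =
      multilinearExtension (slope φ e) y := by
    intro e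
    have h1 : HasDerivAt (fun s : ℝ => y + s • (Pi.single e 1 : ε → ℝ)) (Pi.single e 1) 0 := by
      simpa using ((hasDerivAt_id (0 : ℝ)).smul_const (Pi.single e 1 : ε → ℝ)).const_add y
    have h2 : HasFDerivAt (multilinearExtension φ) (fderiv ℝ (multilinearExtension φ) y)
        (y + (0 : ℝ) • (Pi.single e 1 : ε → ℝ)) := by
      simpa using (differentiable_multilinearExtension φ y).hasFDerivAt
    have h3 := h2.comp_hasDerivAt (0 : ℝ) h1
    have h4 : HasDerivAt (fun s : ℝ => multilinearExtension φ y +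
        s * multilinearExtension (slope φ e) y) (multilinearExtension (slope φ e) y) 0 := by
      simpa using ((hasDerivAt_id (0 : ℝ)).mul_const
        (multilinearExtension (slope φ e) y)).const_add (multilinearExtension φ y)
    refine h3.unique (h4.congr_of_eventuallyEq (Filter.Eventually.of_forall fun s => ?_))
    exact multilinearExtension_add_smul_single φ e y s
  conv_lhs => rw [pi_eq_sum_univ' w]
  rw [map_sum]
  refine Finset.sum_congr rfl fun e _ => ?_
  rw [← key e, map_smul, smul_eq_mul]

/-- The mean value theorem for the multilinear extension. -/
theorem exists_multilinearExtension_sub_eq (φ : Finset ε → ℝ) (y d : ε → ℝ) :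
    ∃ θ : ℝ, 0 < θ ∧ θ < 1 ∧ multilinearExtension φ (y + d) - multilinearExtension φ y =
      ∑ e, d e * multilinearExtension (slope φ e) (y + θ • d) := by
  have hd : ∀ s : ℝ, HasDerivAt (fun s : ℝ => multilinearExtension φ (y + s • d))
      (fderiv ℝ (multilinearExtension φ) (y + s • d) d) s := by
    intro s
    have h1 : HasDerivAt (fun s : ℝ => y + s • d) d s := by
      simpa using ((hasDerivAt_id s).smul_const d).const_add y
    exact (differentiable_multilinearExtension φ _).hasFDerivAt.comp_hasDerivAt s h1
  obtain ⟨θ, hθ, h⟩ := exists_hasDerivAt_eq_slope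
    (fun s : ℝ => multilinearExtension φ (y + s • d)) _ zero_lt_one
    (fun s _ => (hd s).continuousAt.continuousWithinAt) fun s _ => hd s
  refine ⟨θ, hθ.1, hθ.2, ?_⟩
  rw [← fderiv_multilinearExtension, h]
  simp

end Multilinear

/-! ### Saturating demand -/

/-- The demand of a supplier with outside score `u` as a function of the number of consumers. -/
def uniformDemand (u : ℝ) (k : ℕ) : ℝ := k / (k + u)

/-- The increments of `uniformDemand`. -/
def uniformGain (u : ℝ) (k : ℕ) : ℝ := uniformDemand u (k + 1) - uniformDemand u k

theorem uniformDemand_zero (u : ℝ) : uniformDemand u 0 = 0 := by simp [uniformDemand]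

theorem uniformGain_nonneg {u : ℝ} (hu : 0 ≤ u) (k : ℕ) : 0 ≤ uniformGain u k := by
  unfold uniformGain uniformDemand
  rcases k.eq_zero_or_pos with rfl | hk
  · simp only [Nat.cast_zero, zero_div, sub_zero]
    positivity
  · have hk' : (0 : ℝ) < k := by exact_mod_cast hk
    rw [sub_nonneg, div_le_div_iff₀ (by positivity) (by positivity)]
    push_cast
    nlinarith

theorem uniformGain_succ_le {u : ℝ} (hu : 0 ≤ u) (k : ℕ) :
    uniformGain u (k + 1) ≤ uniformGain u k := by
  unfold uniformGain uniformDemand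
  rcases k.eq_zero_or_pos with rfl | hk
  -- The index 0 is treated apart because `u` may be 0: with 0/0 = 0 the second difference at 0 is
  -- 2/((1+u)(2+u)), while the closed form used for positive indices would divide by zero.
  · have h : (1 : ℝ) + u ≠ 0 := by positivity
    have h' : (2 : ℝ) + u ≠ 0 := by positivity
    have : (1 : ℝ) / (1 + u) - (2 / (2 + u) - 1 / (1 + u)) = 2 / ((1 + u) * (2 + u)) := by
      field_simp
      ring
    have h2 : (0 : ℝ) ≤ 2 / ((1 + u) * (2 + u)) := by positivity
    simp only [zero_add, Nat.cast_one, Nat.reduceAdd, Nat.cast_zero, zero_div, sub_zero,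
      Nat.cast_ofNat]
    linarith
  · have hk' : (0 : ℝ) < k := by exact_mod_cast hk
    have : ((k + 1 : ℕ) : ℝ) / ((k + 1 : ℕ) + u) - k / (k + u) -
        (((k + 1 + 1 : ℕ) : ℝ) / ((k + 1 + 1 : ℕ) + u) - ((k + 1 : ℕ) : ℝ) / ((k + 1 : ℕ) + u)) =
        2 * u / ((k + u) * (k + 1 + u) * (k + 1 + 1 + u)) := by
      push_cast
      field_simp
      ring
    have h2 : 0 ≤ 2 * u / ((k + u) * (k + 1 + u) * (k + 1 + 1 + u)) := by positivity
    linarith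

theorem uniformGain_antitone {u : ℝ} (hu : 0 ≤ u) : Antitone (uniformGain u) :=
  antitone_nat_of_succ_le (uniformGain_succ_le hu)

theorem uniformDemand_mono {u : ℝ} (hu : 0 ≤ u) : Monotone (uniformDemand u) :=
  monotone_nat_of_le_succ fun k => sub_nonneg.1 (uniformGain_nonneg hu k)

theorem uniformDemand_nonneg {u : ℝ} (hu : 0 ≤ u) (k : ℕ) : 0 ≤ uniformDemand u k := by
  unfold uniformDemand
  positivity

/-- By concavity, each of the `c` increments after `b` is at most the one at `b`. -/
theorem uniformDemand_add_le {u : ℝ} (hu : 0 ≤ u) (b c : ℕ) :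
    uniformDemand u (b + c) ≤ uniformDemand u b + c * uniformGain u b := by
  induction c with
  | zero => simp
  | succ c ih =>
    have h1 : uniformDemand u (b + (c + 1)) = uniformDemand u (b + c) + uniformGain u (b + c) := by
      simp [uniformGain, add_assoc]
    have h2 := uniformGain_antitone hu (Nat.le_add_right b c)
    rw [h1]
    push_cast
    linarith

/-- The increments at `0, …, b` telescope to the right-hand side, and the last of them is the
smallest. -/
theorem succ_mul_uniformGain_le {u : ℝ} (hu : 0 ≤ u) (b : ℕ) :
    ((b + 1 : ℕ) : ℝ) * uniformGain u b ≤ uniformDemand u (b + 1) := by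
  induction b with
  | zero => simp [uniformGain, uniformDemand_zero]
  | succ b ih =>
    have h1 : uniformDemand u (b + 1 + 1) = uniformDemand u (b + 1) + uniformGain u (b + 1) := by
      simp [uniformGain]
    have h2 := uniformGain_succ_le hu b
    have h3 : ((b + 1 : ℕ) : ℝ) * uniformGain u (b + 1) ≤ (b + 1 : ℕ) * uniformGain u b := by
      gcongr
    rw [h1]
    push_cast at *
    linarith

theorem uniformDemand_le_mul {u : ℝ} (hu : 0 ≤ u) (b : ℕ) :
    uniformDemand u b ≤ b * uniformGain u 0 := by
  simpa [uniformDemand_zero] using uniformDemand_add_le hu 0 b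

/-- The local form of the improved greedy inequality: `b` consumers are present, `k` in the optimum. -/
theorem uniformDemand_exchange {u : ℝ} (hu : 0 ≤ u) {n b k : ℕ} (hn : 0 < n) (hb : b ≤ n)
    (hkn : k ≤ n) :
    uniformDemand u k + (1 / n : ℝ) * (b * uniformGain u (b - 1)) ≤
      uniformDemand u b + (k / n : ℝ) * (b * uniformGain u (b - 1) + (n - b) * uniformGain u b) := by
  have hn' : (0 : ℝ) < n := by exact_mod_cast hn
  have hn1 : (1 : ℝ) ≤ n := by exact_mod_cast hn
  have hb' : (b : ℝ) ≤ n := by exact_mod_cast hb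
  have hD1 : 0 ≤ (b : ℝ) * uniformGain u (b - 1) :=
    mul_nonneg (Nat.cast_nonneg _) (uniformGain_nonneg hu _)
  have hD0 := uniformGain_nonneg hu b
  rcases k.eq_zero_or_pos with rfl | hk
  -- For `k = 0` the derivative term on the right vanishes; the surplus is paid by the present
  -- value, since `b` copies of the last increment are at most the demand at `b`, and 1/n ≤ 1.
  · have h : (b : ℝ) * uniformGain u (b - 1) ≤ uniformDemand u b := by
      cases b with
      | zero => simp [uniformDemand_zero]
      | succ b => exact succ_mul_uniformGain_le hu b
    have h2 : (1 / n : ℝ) * (b * uniformGain u (b - 1)) ≤ 1 * (b * uniformGain u (b - 1)) := by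
      gcongr
      rw [div_le_one hn']
      exact hn1
    simp only [uniformDemand_zero, Nat.cast_zero, zero_div, zero_mul]
    linarith
  -- For `k ≥ 1` the weight `k / n` on the consumers already present is at least `1 / n`, which
  -- covers the surplus. The rest is the usual concavity comparison, with absent consumers only.
  · have hk' : (1 : ℝ) ≤ k := by exact_mod_cast hk
    have h1 : (1 / n : ℝ) * (b * uniformGain u (b - 1)) ≤
        (k / n : ℝ) * (b * uniformGain u (b - 1)) := by gcongr
    have h2 : uniformDemand u k ≤ uniformDemand u b + (k / n : ℝ) * ((n - b) * uniformGain u b) := by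
      rcases le_total k b with h | h
      · have h3 := uniformDemand_mono hu h
        have h4 : 0 ≤ (k / n : ℝ) * ((n - b) * uniformGain u b) :=
          mul_nonneg (by positivity) (mul_nonneg (sub_nonneg.2 hb') hD0)
        linarith
      · obtain ⟨c, rfl⟩ := Nat.exists_eq_add_of_le h
        have h3 := uniformDemand_add_le hu b c
        -- With k = b + c this is k - b ≤ k(n - b)/n, which amounts to kb ≤ nb.
        have h4 : (c : ℝ) ≤ ((b + c : ℕ) : ℝ) / n * (n - b) := by
          rw [div_mul_eq_mul_div, le_div_iff₀ hn']
          have hkn' : ((b + c : ℕ) : ℝ) ≤ n := by exact_mod_cast hkn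
          push_cast at hkn' ⊢
          nlinarith [mul_nonneg (Nat.cast_nonneg (α := ℝ) b) (sub_nonneg.2 hkn')]
        have h5 := mul_le_mul_of_nonneg_right h4 hD0
        linarith
    linarith

/-! ### The welfare function -/

variable {n m : ℕ}

/-- The welfare of an assignment of the consumers to the suppliers. -/
def MNLUniform.assignmentValue (I : MNLUniform n m) (a : Fin n → Fin m) : ℝ :=
  ∑ j, I.r j * uniformDemand (I.u j) (partitionOf a j).card

/-- The largest value of a single pair with supplier `j`. -/
def MNLUniform.weight (I : MNLUniform n m) (j : Fin m) : ℝ := I.r j * uniformGain (I.u j) 0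

theorem demand_uniformChoice {α : Type} [DecidableEq α] (u : ℝ) (S : Finset α) :
    demand (uniformChoice u) S = uniformDemand u S.card := by
  unfold demand uniformDemand
  rw [Finset.sum_congr rfl fun x hx => show uniformChoice u (some x) S = 1 / ((S.card : ℝ) + u) by
    simp [uniformChoice, hx]]
  simp
  ring

theorem MNLUniform.welfare_eq (I : MNLUniform n m) (A : Finset (Fin n × Fin m)) :
    I.welfare A = ∑ j, I.r j * uniformDemand (I.u j) (part A j).card := by
  simp [MNLUniform.welfare, MNLUniform.supplierChoice, demand_uniformChoice]

theorem part_insert_same (A : Finset (Fin n × Fin m)) (e : Fin n × Fin m) :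
    part (insert e A) e.2 = insert e.1 ((part A e.2).erase e.1) := by
  obtain ⟨i, j⟩ := e
  ext i'
  by_cases h : i' = i <;> simp [part, h]

theorem part_erase_same (A : Finset (Fin n × Fin m)) (e : Fin n × Fin m) :
    part (A.erase e) e.2 = (part A e.2).erase e.1 := by
  obtain ⟨i, j⟩ := e
  ext i'
  by_cases h : i' = i <;> simp [part, h]

theorem part_insert_of_ne (A : Finset (Fin n × Fin m)) (e : Fin n × Fin m) {j : Fin m}
    (h : j ≠ e.2) : part (insert e A) j = part A j := by
  ext i'
  simp [part, Prod.ext_iff, h]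

theorem part_erase_of_ne (A : Finset (Fin n × Fin m)) (e : Fin n × Fin m) {j : Fin m}
    (h : j ≠ e.2) : part (A.erase e) j = part A j := by
  ext i'
  simp [part, Prod.ext_iff, h]

theorem MNLUniform.slope_welfare (I : MNLUniform n m) (e : Fin n × Fin m)
    (A : Finset (Fin n × Fin m)) :
    slope I.welfare e A =
      I.r e.2 * uniformGain (I.u e.2) ((part A e.2).erase e.1).card := by
  unfold slope
  rw [I.welfare_eq, I.welfare_eq, ← Finset.sum_sub_distrib, Finset.sum_eq_single e.2]
  · rw [part_insert_same, part_erase_same, Finset.card_insert_of_notMem (by simp), uniformGain,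
      mul_sub]
  · intro j _ hj
    rw [part_insert_of_ne _ _ hj, part_erase_of_ne _ _ hj, sub_self]
  · simp

theorem MNLUniform.slope_welfare_nonneg (I : MNLUniform n m) (e : Fin n × Fin m)
    (A : Finset (Fin n × Fin m)) : 0 ≤ slope I.welfare e A := by
  rw [I.slope_welfare]
  exact mul_nonneg (I.r_nonneg _) (uniformGain_nonneg (I.u_nonneg _) _)

theorem MNLUniform.slope_welfare_le (I : MNLUniform n m) (e : Fin n × Fin m)
    (A : Finset (Fin n × Fin m)) : slope I.welfare e A ≤ I.weight e.2 := by
  rw [I.slope_welfare]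
  exact mul_le_mul_of_nonneg_left (uniformGain_antitone (I.u_nonneg _) (Nat.zero_le _))
    (I.r_nonneg _)

/-- The slope at `e` depends only on the part of the supplier `e.2`, which a pair with another
supplier leaves untouched. Hence only one column enters the bound on the change of a partial
derivative. -/
theorem MNLUniform.slope_slope_welfare_of_ne (I : MNLUniform n m) {e d : Fin n × Fin m}
    (h : d.2 ≠ e.2) (A : Finset (Fin n × Fin m)) : slope (slope I.welfare e) d A = 0 := by
  unfold slope
  rw [← slope, ← slope, I.slope_welfare, I.slope_welfare, part_insert_of_ne _ _ h.symm,
    part_erase_of_ne _ _ h.symm, sub_self]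

theorem MNLUniform.weight_nonneg (I : MNLUniform n m) (j : Fin m) : 0 ≤ I.weight j :=
  mul_nonneg (I.r_nonneg _) (uniformGain_nonneg (I.u_nonneg _) _)

theorem sum_partitionOf_card (a : Fin n → Fin m) : ∑ j, (partitionOf a j).card = n := by
  have := Finset.card_eq_sum_card_fiberwise (f := a) (s := Finset.univ) (t := Finset.univ)
    (by simp)
  simpa [partitionOf] using this.symm

theorem card_erase_part (A : Finset (Fin n × Fin m)) (i : Fin n) (j : Fin m) :
    ((part A j).erase i).card = if (i, j) ∈ A then (part A j).card - 1 else (part A j).card := by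
  split_ifs with h
  · exact Finset.card_erase_of_mem (by simpa [part] using h)
  · rw [Finset.erase_eq_of_notMem (by simpa [part] using h)]

theorem MNLUniform.sum_slope_welfare (I : MNLUniform n m) (A : Finset (Fin n × Fin m)) (j : Fin m) :
    ∑ i, slope I.welfare (i, j) A = I.r j * ((part A j).card *
      uniformGain (I.u j) ((part A j).card - 1) +
        (n - (part A j).card) * uniformGain (I.u j) (part A j).card) := by
  have hc : (Finset.univ.filter fun i : Fin n => (i, j) ∉ A).card = n - (part A j).card := by
    have := Finset.card_filter_add_card_filter_not (s := Finset.univ) fun i : Fin n => (i, j) ∈ A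
    simp only [Finset.card_univ, Fintype.card_fin] at this
    unfold part
    omega
  have hle : (part A j).card ≤ n := by simpa using Finset.card_le_univ (part A j)
  have h : ∀ i, slope I.welfare (i, j) A = if (i, j) ∈ A
      then I.r j * uniformGain (I.u j) ((part A j).card - 1)
      else I.r j * uniformGain (I.u j) (part A j).card := by
    intro i
    rw [I.slope_welfare, card_erase_part]
    split_ifs <;> rfl
  simp only [h, Finset.sum_ite, Finset.sum_const]
  rw [hc]
  simp only [nsmul_eq_mul, Nat.cast_sub hle]
  unfold part
  ring

theorem MNLUniform.sum_mem_slope_welfare (I : MNLUniform n m) (A : Finset (Fin n × Fin m))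
    (j : Fin m) :
    ∑ i, (if (i, j) ∈ A then slope I.welfare (i, j) A else 0) =
      I.r j * ((part A j).card * uniformGain (I.u j) ((part A j).card - 1)) := by
  have h : ∀ i, (if (i, j) ∈ A then slope I.welfare (i, j) A else 0) =
      if (i, j) ∈ A then I.r j * uniformGain (I.u j) ((part A j).card - 1) else 0 := by
    intro i
    split_ifs with hi
    · rw [I.slope_welfare, card_erase_part, if_pos hi]
    · rfl
  simp only [h, Finset.sum_ite, Finset.sum_const, nsmul_eq_mul]
  unfold part
  simp
  ring

/-- The improved greedy inequality. -/
theorem MNLUniform.assignmentValue_le (I : MNLUniform n m) (hn : 0 < n) (a : Fin n → Fin m)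
    {y : Fin n × Fin m → ℝ} (h0 : ∀ e, 0 ≤ y e) (h1 : ∀ e, y e ≤ 1) :
    I.assignmentValue a + (1 / n : ℝ) * ∑ e, y e * multilinearExtension (slope I.welfare e) y ≤
      multilinearExtension I.welfare y + ∑ e : Fin n × Fin m,
        ((partitionOf a e.2).card / n : ℝ) * multilinearExtension (slope I.welfare e) y := by
  -- Both sides are expectations over the random set `A`, so it suffices to compare integrands.
  -- These split over the suppliers, and each supplier contributes `uniformDemand_exchange` with b =
  -- |A_j| and k the size of its part under `a`.
  have key : multilinearExtension (fun A => I.assignmentValue a +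
      (1 / n : ℝ) * ∑ e, if e ∈ A then slope I.welfare e A else 0) y ≤
      multilinearExtension (fun A => I.welfare A + ∑ e : Fin n × Fin m,
        ((partitionOf a e.2).card / n : ℝ) * slope I.welfare e A) y := by
    refine multilinearExtension_mono (fun A => ?_) h0 h1
    rw [Fintype.sum_prod_type_right, Fintype.sum_prod_type_right, I.welfare_eq,
      MNLUniform.assignmentValue, Finset.mul_sum, ← Finset.sum_add_distrib,
      ← Finset.sum_add_distrib]
    refine Finset.sum_le_sum fun j _ => ?_
    rw [I.sum_mem_slope_welfare]
    dsimp only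
    rw [← Finset.mul_sum, I.sum_slope_welfare]
    have := mul_le_mul_of_nonneg_left (uniformDemand_exchange (I.u_nonneg j)
      (k := (partitionOf a j).card) hn (b := (part A j).card)
      (by simpa using Finset.card_le_univ (part A j))
      (by simpa using Finset.card_le_univ (partitionOf a j))) (I.r_nonneg j)
    linarith
  simp only [multilinearExtension_add, multilinearExtension_const, multilinearExtension_const_mul,
    multilinearExtension_sum, ← mul_multilinearExtension_slope] at key
  exact key

theorem MNLUniform.multilinearExtension_slope_nonneg (I : MNLUniform n m) (e : Fin n × Fin m)
    {y : Fin n × Fin m → ℝ} (h0 : ∀ e, 0 ≤ y e) (h1 : ∀ e, y e ≤ 1) :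
    0 ≤ multilinearExtension (slope I.welfare e) y := by
  have := multilinearExtension_mono (φ := fun _ => 0) (I.slope_welfare_nonneg e) h0 h1
  rwa [multilinearExtension_const] at this

/-- The partial derivatives of the multilinear extension decrease slowly. -/
theorem MNLUniform.multilinearExtension_slope_ge (I : MNLUniform n m) (e : Fin n × Fin m)
    {y d : Fin n × Fin m → ℝ} (h0 : ∀ e, 0 ≤ y e) (hd : ∀ e, 0 ≤ d e) (h1 : ∀ e, y e + d e ≤ 1) :
    multilinearExtension (slope I.welfare e) y - I.weight e.2 * ∑ i, d (i, e.2) ≤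
      multilinearExtension (slope I.welfare e) (y + d) := by
  obtain ⟨θ, hθ0, hθ1, h⟩ := exists_multilinearExtension_sub_eq (slope I.welfare e) y d
  have hq0 : ∀ e, 0 ≤ (y + θ • d) e := fun e => add_nonneg (h0 e) (mul_nonneg hθ0.le (hd e))
  have hq1 : ∀ e, (y + θ • d) e ≤ 1 := fun e => by
    have : θ * d e ≤ 1 * d e := mul_le_mul_of_nonneg_right hθ1.le (hd e)
    have := h1 e
    simp only [Pi.add_apply, Pi.smul_apply, smul_eq_mul]
    linarith
  -- A second difference is a difference of two slopes in [0, weight], hence at least -weight; it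
  -- vanishes across different suppliers.
  have hs : ∀ b : Fin n × Fin m, (if b.2 = e.2 then -(d b * I.weight e.2) else 0) ≤
      d b * multilinearExtension (slope (slope I.welfare e) b) (y + θ • d) := by
    intro b
    split_ifs with hb
    · rw [← mul_neg]
      refine mul_le_mul_of_nonneg_left ?_ (hd b)
      have := multilinearExtension_mono (φ := fun _ => -I.weight e.2)
        (ψ := slope (slope I.welfare e) b) (fun A => by
          have h1 := I.slope_welfare_le e (A.erase b)
          have h2 := I.slope_welfare_nonneg e (insert b A)
          rw [slope]
          linarith) hq0 hq1
      rwa [multilinearExtension_const] at this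
    · rw [show slope (slope I.welfare e) b = fun _ => 0 from
        funext fun A => I.slope_slope_welfare_of_ne hb A, multilinearExtension_const, mul_zero]
  have hsum := Finset.sum_le_sum fun b (_ : b ∈ Finset.univ) => hs b
  rw [← h, Fintype.sum_prod_type_right, Finset.sum_eq_single e.2] at hsum
  · simp only [if_true, Finset.sum_neg_distrib, ← Finset.sum_mul] at hsum
    linarith
  · intro j _ hj
    simp [hj]
  · simp

/-- Concave demand lies below its tangent at 0, so welfare is at most a modular function, whose
multilinear extension is linear. -/
theorem MNLUniform.multilinearExtension_le_sum_weight (I : MNLUniform n m)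
    {y : Fin n × Fin m → ℝ} (h0 : ∀ e, 0 ≤ y e) (h1 : ∀ e, y e ≤ 1) :
    multilinearExtension I.welfare y ≤ ∑ e, y e * I.weight e.2 := by
  have key : multilinearExtension I.welfare y ≤ multilinearExtension (fun A => ∑ e : Fin n × Fin m,
      I.weight e.2 * if e ∈ A then 1 else 0) y := by
    refine multilinearExtension_mono (fun A => ?_) h0 h1
    rw [Fintype.sum_prod_type_right, I.welfare_eq]
    refine Finset.sum_le_sum fun j _ => ?_
    dsimp only
    rw [← Finset.mul_sum, MNLUniform.weight, mul_assoc]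
    refine mul_le_mul_of_nonneg_left ?_ (I.r_nonneg j)
    have := uniformDemand_le_mul (I.u_nonneg j) (part A j).card
    rw [mul_comm] at this
    simpa [part] using this
  simp only [multilinearExtension_const_mul, multilinearExtension_sum,
    multilinearExtension_mem] at key
  simpa only [mul_comm] using key

theorem MNLUniform.multilinearExtension_slope_zero (I : MNLUniform n m) (e : Fin n × Fin m) :
    multilinearExtension (slope I.welfare e) 0 = I.weight e.2 := by
  have h : ∀ φ : Finset (Fin n × Fin m) → ℝ, multilinearExtension φ 0 = φ ∅ := by
    intro φ
    unfold multilinearExtension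
    rw [Finset.sum_eq_single ∅]
    · simp
    · intro A _ hA
      obtain ⟨e, he⟩ := Finset.nonempty_iff_ne_empty.2 hA
      rw [Finset.prod_eq_zero he (by simp)]
      simp
    · simp
  rw [h, I.slope_welfare]
  simp [part, MNLUniform.weight]

theorem MNLUniform.multilinearExtension_zero (I : MNLUniform n m) :
    multilinearExtension I.welfare 0 = 0 := by
  refine le_antisymm ?_ ?_
  · simpa using I.multilinearExtension_le_sum_weight (y := 0) (by simp) (by simp)
  · have := multilinearExtension_mono (φ := fun _ => 0) (ψ := I.welfare) (y := 0) (fun A => by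
      rw [I.welfare_eq]
      exact Finset.sum_nonneg fun j _ => mul_nonneg (I.r_nonneg _)
        (uniformDemand_nonneg (I.u_nonneg _) _)) (by simp) (by simp)
    rwa [multilinearExtension_const] at this

/-! ### The recursion of the continuous greedy algorithm -/

theorem one_div_nine_le_exp_neg_two : (1 : ℝ) / 9 ≤ Real.exp (-2) := by
  rw [Real.exp_neg, ← one_div]
  refine one_div_le_one_div_of_le (Real.exp_pos _) ?_
  have h : Real.exp 1 ≤ 3 := by linarith [Real.exp_one_lt_d9]
  calc Real.exp 2 = Real.exp 1 * Real.exp 1 := by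
        rw [← Real.exp_add]
        norm_num
    _ ≤ 3 * 3 := mul_le_mul h h (Real.exp_pos _).le (by norm_num)
    _ = 9 := by norm_num

/-- For δ ≤ 1/2, 1/(1 - δ) ≤ 1 + 2δ ≤ exp(2δ). -/
theorem exp_neg_two_mul_le {δ : ℝ} (h0 : 0 ≤ δ) (h1 : δ ≤ 1 / 2) :
    Real.exp (-(2 * δ)) ≤ 1 - δ := by
  rw [Real.exp_neg]
  refine inv_le_of_inv_le₀ (by linarith) (le_trans ?_ (Real.add_one_le_exp (2 * δ)))
  rw [inv_le_iff_one_le_mul₀ (by linarith)]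
  nlinarith

set_option maxHeartbeats 600000 in
-- Without the surplus, `h1` alone gives (1 - 1/e) times a target lowered by the discretization
-- error. The surplus in `h2`, available during the first T/(2n) steps, creates an excess of order
-- W/n³; a constant fraction of it survives to the end and exceeds the error n²W/T.
theorem one_sub_exp_le_of_recursion {n T : ℕ} (hn : 1 ≤ n) (hT : 1000 * n ^ 5 ≤ T) {W : ℝ}
    (hW : 0 ≤ W) {F : ℕ → ℝ} (h0 : F 0 = 0)
    (h1 : ∀ t < T, F t + 1 / T * (W - F t) - n ^ 2 * W / T ^ 2 ≤ F (t + 1))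
    (h2 : ∀ t < T, 2 * n * t ≤ T →
      F t + 1 / T * (W - F t + 1 / n * (F t / 2)) - n ^ 2 * W / T ^ 2 ≤ F (t + 1)) :
    (1 - Real.exp (-1)) * W ≤ F T := by
  have hn' : (1 : ℝ) ≤ n := by exact_mod_cast hn
  have hT' : 1000 * (n : ℝ) ^ 5 ≤ T := by exact_mod_cast hT
  have hn5 : (1 : ℝ) ≤ (n : ℝ) ^ 5 := one_le_pow₀ hn'
  have hTpos : (0 : ℝ) < T := by linarith
  obtain ⟨δ, hδ⟩ : ∃ δ : ℝ, δ = 1 / T := ⟨_, rfl⟩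
  have hδ0 : 0 < δ := by rw [hδ]; positivity
  have hδT : δ * T = 1 := by rw [hδ]; field_simp
  have hδn : δ * (1000 * (n : ℝ) ^ 5) ≤ 1 := by
    rw [← hδT]
    gcongr
  have hδ1 : δ ≤ 1 / 1000 := by nlinarith
  -- `A` is the target after the error of every step has been absorbed; the recursion becomes F(t+1)
  -- ≥ (1 - δ) F(t) + δA.
  obtain ⟨A, hA⟩ : ∃ A : ℝ, A = (1 - δ * n ^ 2) * W := ⟨_, rfl⟩
  have hn2 : δ * (n : ℝ) ^ 2 * (1000 * n ^ 3) ≤ 1 := by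
    calc δ * (n : ℝ) ^ 2 * (1000 * n ^ 3) = δ * (1000 * (n : ℝ) ^ 5) := by ring
      _ ≤ 1 := hδn
  have hn3 : (1 : ℝ) ≤ (n : ℝ) ^ 3 := one_le_pow₀ hn'
  have hδn2 : δ * (n : ℝ) ^ 2 ≤ 1 / 1000 := by
    have : 0 ≤ δ * (n : ℝ) ^ 2 := by positivity
    nlinarith
  have hA0 : 0 ≤ A := by
    rw [hA]
    exact mul_nonneg (by linarith) hW
  have herr : (n : ℝ) ^ 2 * W / T ^ 2 = δ * (δ * n ^ 2 * W) := by
    rw [hδ]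
    field_simp
  have h1' : ∀ t < T, (1 - δ) * F t + δ * A ≤ F (t + 1) := by
    intro t ht
    have := h1 t ht
    rw [herr, ← hδ] at this
    rw [hA]
    linarith
  have h2' : ∀ t < T, 2 * n * t ≤ T → (1 - δ) * F t + δ * A + δ / (2 * n) * F t ≤ F (t + 1) := by
    intro t ht htn
    have := h2 t ht htn
    rw [herr, ← hδ] at this
    rw [hA]
    have h3 : δ / (2 * n) * F t = δ * (1 / n * (F t / 2)) := by ring
    rw [h3]
    linarith
  -- A crude linear lower bound, needed only to feed the surplus term, which is proportional to F.
  have hlin : ∀ t ≤ T, A * t * δ / 2 ≤ F t := by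
    intro t
    induction t with
    | zero => simp [h0]
    | succ t ih =>
      intro ht
      have h3 := ih (by omega)
      have h4 := h1' t (by omega)
      have h5 : δ * (t : ℝ) ≤ 1 := by
        rw [← hδT]
        gcongr
        omega
      have h6 : (1 - δ) * (A * t * δ / 2) ≤ (1 - δ) * F t :=
        mul_le_mul_of_nonneg_left h3 (by linarith)
      have h7 : 0 ≤ A * δ * (1 - δ * t) := mul_nonneg (by positivity) (by linarith)
      push_cast
      linarith
  set s := T / (2 * n) with hs
  have hsT : s * (2 * n) ≤ T := Nat.div_mul_le_self _ _
  have hsT' : T < (s + 1) * (2 * n) := by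
    have := Nat.lt_div_mul_add (a := T) (b := 2 * n) (by omega)
    rw [← hs] at this
    linarith
  have hsle : s ≤ T := Nat.div_le_self _ _
  -- The linear bound makes the surplus of step t at least Atδ²/(4n) = 3κtδ². Of this, 2κtδ² pays
  -- for the growth of t(t - 1), and κtδ² covers the decay by the factor 1 - δ, because δt ≤ 1.
  obtain ⟨κ, hκ⟩ : ∃ κ : ℝ, κ = A / (12 * n) := ⟨_, rfl⟩
  have hκ0 : 0 ≤ κ := by rw [hκ]; positivity
  have hquad : ∀ t ≤ s, A * (1 - (1 - δ) ^ t) + κ * (t * (t - 1)) * δ ^ 2 ≤ F t := by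
    intro t
    induction t with
    | zero => simp [h0]
    | succ t ih =>
      intro ht
      have h3 := ih (by omega)
      have h4 := h2' t (by omega) (by nlinarith)
      have h5 : δ * (t : ℝ) ≤ 1 := by
        rw [← hδT]
        gcongr
        omega
      have h6 : (1 - δ) * (A * (1 - (1 - δ) ^ t) + κ * (t * (t - 1)) * δ ^ 2) ≤ (1 - δ) * F t :=
        mul_le_mul_of_nonneg_left h3 (by linarith)
      have h7 : δ / (2 * n) * (A * t * δ / 2) ≤ δ / (2 * n) * F t :=
        mul_le_mul_of_nonneg_left (hlin t (by omega)) (by positivity)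
      have h8 : δ / (2 * n) * (A * t * δ / 2) = 3 * κ * t * δ ^ 2 := by
        rw [hκ]
        field_simp
        ring
      have h9 : 0 ≤ κ * t * δ ^ 2 * (1 - δ * t) := mul_nonneg (by positivity) (by linarith)
      have h10 : 0 ≤ κ * t * δ ^ 3 := by positivity
      push_cast
      rw [pow_succ (1 - δ)]
      linarith
  -- As sδn is close to 1/2, the excess κs(s - 1)δ² is close to A/(48n³); 60 leaves room for the
  -- rounding in `s`.
  have hbump : A / (60 * n ^ 3) ≤ F s - A * (1 - (1 - δ) ^ s) := by
    have h3 := hquad s le_rfl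
    have h4 : (T : ℝ) ≤ (s + 1) * (2 * n) := by exact_mod_cast hsT'.le
    have h5 : 1 ≤ (s * δ + δ) * (2 * n) := by
      calc (1 : ℝ) = δ * T := hδT.symm
        _ ≤ δ * ((s + 1) * (2 * n)) := by gcongr
        _ = _ := by ring
    have hδn1 : δ * n ≤ 1 / 1000 := by
      have : δ * (n : ℝ) ≤ δ * n ^ 2 := by
        gcongr
        exact le_self_pow₀ hn' (by norm_num)
      linarith
    have h6 : (499 : ℝ) / 1000 ≤ s * δ * n := by nlinarith
    have h7 : (498 : ℝ) / 1000 ≤ (s - 1) * δ * n := by nlinarith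
    have h8 : (1 : ℝ) / 5 ≤ (s * δ * n) * ((s - 1) * δ * n) := by
      have := mul_le_mul h6 h7 (by norm_num) (by linarith)
      linarith
    have h9 : A / (60 * n ^ 3) = A / (12 * n ^ 3) * (1 / 5) := by
      field_simp
      ring
    have h10 : κ * (s * (s - 1)) * δ ^ 2 =
        A / (12 * n ^ 3) * ((s * δ * n) * ((s - 1) * δ * n)) := by
      rw [hκ]
      field_simp
    have h11 : A / (12 * n ^ 3) * (1 / 5) ≤
        A / (12 * n ^ 3) * ((s * δ * n) * ((s - 1) * δ * n)) :=
      mul_le_mul_of_nonneg_left h8 (by positivity)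
    linarith
  -- After step `s` only `h1'` is used: the excess over A(1 - (1 - δ)^t) shrinks by at most the
  -- factor 1 - δ per step.
  have htail : ∀ k, s + k ≤ T → A / (60 * n ^ 3) * (1 - δ) ^ k ≤
      F (s + k) - A * (1 - (1 - δ) ^ (s + k)) := by
    intro k
    induction k with
    | zero => simpa using fun _ => hbump
    | succ k ih =>
      intro hk
      have h3 := ih (by omega)
      have h4 := h1' (s + k) (by omega)
      have h5 := mul_le_mul_of_nonneg_left h3 (show 0 ≤ 1 - δ by linarith)
      rw [← add_assoc, pow_succ (1 - δ), pow_succ (1 - δ)]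
      linarith
  have hend := htail (T - s) (by omega)
  rw [Nat.add_sub_cancel' hsle] at hend
  have hup : (1 - δ) ^ T ≤ Real.exp (-1) := by
    calc (1 - δ) ^ T ≤ Real.exp (-δ) ^ T :=
          pow_le_pow_left₀ (by linarith) (Real.one_sub_le_exp_neg δ) _
      _ = Real.exp (-1) := by
          rw [← Real.exp_nat_mul]
          congr 1
          linarith
  have hlow : 1 / 9 ≤ (1 - δ) ^ (T - s) := by
    have h3 := exp_neg_two_mul_le hδ0.le (by linarith : δ ≤ 1 / 2)
    calc (1 : ℝ) / 9 ≤ Real.exp (-2) := one_div_nine_le_exp_neg_two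
      _ = Real.exp (-(2 * δ)) ^ T := by
          rw [← Real.exp_nat_mul]
          congr 1
          linarith
      _ ≤ (1 - δ) ^ T := pow_le_pow_left₀ (Real.exp_pos _).le h3 _
      _ ≤ (1 - δ) ^ (T - s) := pow_le_pow_of_le_one (by linarith) (by linarith) (Nat.sub_le _ _)
  have h3 : A / (60 * n ^ 3) * (1 / 9) ≤ A / (60 * n ^ 3) * (1 - δ) ^ (T - s) :=
    mul_le_mul_of_nonneg_left hlow (by positivity)
  have h4 : A * (1 - δ) ^ T ≤ A * Real.exp (-1) := mul_le_mul_of_nonneg_left hup hA0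
  have h5 : A * (1 - Real.exp (-1)) + A / (540 * n ^ 3) ≤ F T := by
    have : A / (60 * n ^ 3) * (1 / 9) = A / (540 * n ^ 3) := by
      field_simp
      ring
    linarith
  refine le_trans ?_ h5
  -- Here 540 δn⁵ ≤ 0.54, while 1 - δn² ≥ 0.999: the surviving excess outweighs the loss in `A`.
  have h6 : δ * n ^ 2 ≤ (1 - δ * n ^ 2) / (540 * n ^ 3) := by
    rw [le_div_iff₀ (by positivity)]
    nlinarith
  have h7 : 0 < Real.exp (-1) := Real.exp_pos _
  have h8 : A / (540 * n ^ 3) = W * ((1 - δ * n ^ 2) / (540 * n ^ 3)) := by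
    rw [hA]
    ring
  have h9 : W * (δ * n ^ 2) ≤ W * ((1 - δ * n ^ 2) / (540 * n ^ 3)) :=
    mul_le_mul_of_nonneg_left h6 hW
  have h10 : 0 ≤ W * (δ * n ^ 2) := by positivity
  have h11 : 0 ≤ Real.exp (-1) * (W * (δ * n ^ 2)) := by positivity
  rw [h8, hA]
  linarith

/-! ### The partition polytope -/

/-- This inclusion suffices for upper bounds over the polytope; lower bounds are witnessed by
assignment vectors, so the converse is never needed. -/
theorem partitionPolytope_subset :
    partitionPolytope n m ⊆ {z | (∀ e, 0 ≤ z e) ∧ ∀ i, ∑ j, z (i, j) ≤ 1} := by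
  refine convexHull_min ?_ ?_
  · rintro _ ⟨A, hA, rfl⟩
    refine ⟨fun e => by dsimp only; split_ifs <;> norm_num, fun i => ?_⟩
    have h := hA i
    have h2 : (Finset.univ.filter fun j => (i, j) ∈ A).card ≤
        (A.filter fun e => e.1 = i).card :=
      Finset.card_le_card_of_injOn (fun j => (i, j)) (fun j hj => by simpa using hj)
        fun a _ b _ hab => by simpa using hab
    have h3 : (Finset.univ.filter fun j => (i, j) ∈ A).card ≤ 1 := h2.trans h
    simp only [Finset.sum_boole]
    exact_mod_cast h3
  · rintro z ⟨hz, hz1⟩ w ⟨hw, hw1⟩ a b ha hb hab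
    refine ⟨fun e => add_nonneg (mul_nonneg ha (hz e)) (mul_nonneg hb (hw e)), fun i => ?_⟩
    simp only [Pi.add_apply, Pi.smul_apply, smul_eq_mul, Finset.sum_add_distrib, ← Finset.mul_sum]
    have h1 := mul_le_mul_of_nonneg_left (hz1 i) ha
    have h2 := mul_le_mul_of_nonneg_left (hw1 i) hb
    linarith

/-- The indicator vector of an assignment. -/
def assignmentVector (a : Fin n → Fin m) : Fin n × Fin m → ℝ := fun e => if e.2 = a e.1 then 1 else 0

theorem assignmentVector_mem (a : Fin n → Fin m) : assignmentVector a ∈ partitionPolytope n m := by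
  refine subset_convexHull ℝ _ ⟨Finset.univ.image fun i => (i, a i), fun i => ?_, ?_⟩
  · rw [Finset.card_le_one]
    rintro ⟨i₁, j₁⟩ h₁ ⟨i₂, j₂⟩ h₂
    simp only [Finset.mem_filter, Finset.mem_image, Finset.mem_univ, true_and, Prod.mk.injEq] at *
    obtain ⟨⟨_, rfl, rfl⟩, rfl⟩ := h₁
    obtain ⟨⟨_, rfl, rfl⟩, rfl⟩ := h₂
    exact ⟨rfl, rfl⟩
  · funext e
    simp only [assignmentVector, Finset.mem_image, Finset.mem_univ, true_and]
    refine if_congr ⟨?_, fun h => ⟨e.1, Prod.ext rfl h.symm⟩⟩ rfl rfl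
    rintro ⟨i, rfl⟩
    rfl

theorem sum_assignmentVector_mul (a : Fin n → Fin m) (g : Fin n × Fin m → ℝ) :
    ∑ e, assignmentVector a e * g e = ∑ i, g (i, a i) := by
  rw [Fintype.sum_prod_type]
  refine Finset.sum_congr rfl fun i _ => ?_
  rw [Finset.sum_eq_single (a i)]
  · simp [assignmentVector]
  · intro j _ hj
    simp [assignmentVector, hj]
  · simp

/-- A maximizing direction is at least as good as every fractional assignment with the same rows. -/
theorem le_of_isMaxOn_partitionPolytope (hn : 0 < n) {g : Fin n × Fin m → ℝ} {k : Fin m → ℕ}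
    (hk : ∑ j, k j = n) {z : Fin n × Fin m → ℝ}
    (hz : ∀ w ∈ partitionPolytope n m, ∑ e, w e * g e ≤ ∑ e, z e * g e) :
    ∑ e : Fin n × Fin m, (k e.2 / n : ℝ) * g e ≤ ∑ e, z e * g e := by
  have hn' : (0 : ℝ) < n := by exact_mod_cast hn
  have hm : Nonempty (Fin m) := by
    by_contra h
    rw [not_nonempty_iff] at h
    rw [Finset.univ_eq_empty, Finset.sum_empty] at hk
    omega
  -- The integral assignment of every consumer to its best supplier dominates each row average, so
  -- the fractional point itself need not be shown to lie in the polytope.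
  choose a ha using fun i : Fin n => Finite.exists_max fun j : Fin m => g (i, j)
  have h := hz _ (assignmentVector_mem a)
  rw [sum_assignmentVector_mul] at h
  refine le_trans ?_ h
  rw [Fintype.sum_prod_type]
  refine Finset.sum_le_sum fun i _ => ?_
  calc ∑ j, (k j / n : ℝ) * g (i, j) ≤ ∑ j, (k j / n : ℝ) * g (i, a i) :=
        Finset.sum_le_sum fun j _ => mul_le_mul_of_nonneg_left (ha i j) (by positivity)
    _ = g (i, a i) := by
        rw [← Finset.sum_mul, ← Finset.sum_div]
        have : (∑ j, (k j : ℝ)) = n := by exact_mod_cast hk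
        rw [this, div_self hn'.ne', one_mul]

/-! ### The value of the continuous greedy algorithm -/

theorem IsContinuousGreedyRun.nonneg {f : Finset (Fin n × Fin m) → ℝ} {T : ℕ}
    {y : ℕ → Fin n × Fin m → ℝ} (h : IsContinuousGreedyRun f T y) {t : ℕ} (ht : t ≤ T)
    (e : Fin n × Fin m) : 0 ≤ y t e := by
  induction t with
  | zero => simp [h.start]
  | succ t ih =>
    obtain ⟨z, hz, -, -, hy⟩ := h.step t (by omega)
    rw [hy]
    exact add_nonneg (ih (by omega))
      (mul_nonneg (by positivity) ((partitionPolytope_subset hz).1 e))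

theorem IsContinuousGreedyRun.row_sum {f : Finset (Fin n × Fin m) → ℝ} {T : ℕ}
    {y : ℕ → Fin n × Fin m → ℝ} (h : IsContinuousGreedyRun f T y) {t : ℕ} (ht : t ≤ T)
    (i : Fin n) : ∑ j, y t (i, j) = t / T := by
  induction t with
  | zero => simp [h.start]
  | succ t ih =>
    obtain ⟨z, -, -, hz, hy⟩ := h.step t (by omega)
    simp only [hy, Pi.add_apply, Pi.smul_apply, smul_eq_mul, Finset.sum_add_distrib,
      ← Finset.mul_sum, hz i, ih (by omega)]
    push_cast
    ring

theorem IsContinuousGreedyRun.le_div {f : Finset (Fin n × Fin m) → ℝ} {T : ℕ}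
    {y : ℕ → Fin n × Fin m → ℝ} (h : IsContinuousGreedyRun f T y) {t : ℕ} (ht : t ≤ T)
    (e : Fin n × Fin m) : y t e ≤ t / T := by
  rw [← h.row_sum ht e.1]
  exact Finset.single_le_sum (f := fun j => y t (e.1, j)) (fun j _ => h.nonneg ht _)
    (Finset.mem_univ e.2)

theorem IsContinuousGreedyRun.le_one {f : Finset (Fin n × Fin m) → ℝ} {T : ℕ}
    {y : ℕ → Fin n × Fin m → ℝ} (h : IsContinuousGreedyRun f T y) {t : ℕ} (ht : t ≤ T)
    (e : Fin n × Fin m) : y t e ≤ 1 :=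
  (h.le_div ht e).trans (div_le_one_of_le₀ (by exact_mod_cast ht) (by positivity))

/-- Giving all consumers to `j` is an assignment. Through this bound the discretization error
becomes proportional to the optimum. -/
theorem MNLUniform.weight_le_assignmentValue (I : MNLUniform n m) (hn : 0 < n) (j : Fin m) :
    I.weight j ≤ I.assignmentValue fun _ => j := by
  have h : ∀ j', 0 ≤ I.r j' * uniformDemand (I.u j') (partitionOf (fun _ : Fin n => j) j').card :=
    fun j' => mul_nonneg (I.r_nonneg _) (uniformDemand_nonneg (I.u_nonneg _) _)
  refine le_trans ?_ (Finset.single_le_sum (fun j' _ => h j') (Finset.mem_univ j))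
  refine mul_le_mul_of_nonneg_left ?_ (I.r_nonneg j)
  have : (partitionOf (fun _ : Fin n => j) j).card = n := by simp [partitionOf]
  rw [this]
  calc uniformGain (I.u j) 0 = uniformDemand (I.u j) 1 := by
        simp [uniformGain, uniformDemand_zero]
    _ ≤ uniformDemand (I.u j) n := uniformDemand_mono (I.u_nonneg j) hn

theorem MNLUniform.assignmentValue_nonneg (I : MNLUniform n m) (a : Fin n → Fin m) :
    0 ≤ I.assignmentValue a :=
  Finset.sum_nonneg fun _ _ => mul_nonneg (I.r_nonneg _) (uniformDemand_nonneg (I.u_nonneg _) _)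

/-- By the mean value theorem, a step gains its first-order term up to the change of the partial
derivatives along the way. A column moves by at most n/T, so each derivative drops by at most nW/T;
the direction has total mass n and the step length is 1/T, whence the error n²W/T². The first-order
term is bounded below by `MNLUniform.assignmentValue_le`, because the direction is maximizing. -/
theorem MNLUniform.greedy_step (I : MNLUniform n m) (hn : 0 < n) {a : Fin n → Fin m}
    (ha : ∀ b, I.assignmentValue b ≤ I.assignmentValue a) {T : ℕ}
    {y : ℕ → Fin n × Fin m → ℝ} (hy : IsContinuousGreedyRun I.welfare T y) {t : ℕ} (ht : t < T) :
    multilinearExtension I.welfare (y t) + 1 / T * (I.assignmentValue a -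
      multilinearExtension I.welfare (y t) +
        1 / n * ∑ e, y t e * multilinearExtension (slope I.welfare e) (y t)) -
          n ^ 2 * I.assignmentValue a / T ^ 2 ≤ multilinearExtension I.welfare (y (t + 1)) := by
  obtain ⟨z, hzP, hzmax, hz1, hyz⟩ := hy.step t ht
  have hz0 := (partitionPolytope_subset hzP).1
  have hT : (0 : ℝ) < T := by exact_mod_cast (by omega : 0 < T)
  have hzle : ∀ e, z e ≤ 1 := fun e => by
    rw [← hz1 e.1]
    exact Finset.single_le_sum (f := fun j => z (e.1, j)) (fun j _ => hz0 _) (Finset.mem_univ e.2)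
  have hW := I.assignmentValue_nonneg a
  have hsumz : ∑ e, z e = n := by
    rw [Fintype.sum_prod_type]
    simp [hz1]
  have hmax := le_of_isMaxOn_partitionPolytope hn (sum_partitionOf_card a)
    (g := fun e => multilinearExtension (slope I.welfare e) (y t)) (z := z) fun w hw => by
      have := hzmax hw
      simpa only [Set.mem_ofPred_eq, fderiv_multilinearExtension] using this
  have hmain := I.assignmentValue_le hn a (hy.nonneg ht.le) (hy.le_one ht.le)
  obtain ⟨θ, hθ0, hθ1, h⟩ := exists_multilinearExtension_sub_eq I.welfare (y t) ((1 / T : ℝ) • z)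
  have hterm : ∀ e, 1 / T * (z e * multilinearExtension (slope I.welfare e) (y t)) -
      z e * (n * I.assignmentValue a / T ^ 2) ≤ ((1 / T : ℝ) • z) e *
        multilinearExtension (slope I.welfare e) (y t + θ • ((1 / T : ℝ) • z)) := by
    intro e
    have hd : ∀ e, (θ • ((1 / T : ℝ) • z)) e ≤ 1 / T * z e := fun e => by
      simp only [Pi.smul_apply, smul_eq_mul]
      exact mul_le_of_le_one_left (mul_nonneg (by positivity) (hz0 e)) hθ1.le
    have h1 := I.multilinearExtension_slope_ge e (y := y t) (d := θ • ((1 / T : ℝ) • z))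
      (hy.nonneg ht.le)
      (fun e => mul_nonneg hθ0.le (mul_nonneg (by positivity) (hz0 e))) fun e => by
        have h2 := hy.le_one (t := t + 1) ht e
        have h3 := hd e
        simp only [hyz, Pi.add_apply, Pi.smul_apply, smul_eq_mul] at h2 h3 ⊢
        linarith
    have h2 : ∑ i, (θ • ((1 / T : ℝ) • z)) (i, e.2) ≤ n / T := by
      calc ∑ i, (θ • ((1 / T : ℝ) • z)) (i, e.2) ≤ ∑ _i : Fin n, (1 / T : ℝ) :=
            Finset.sum_le_sum fun i _ => (hd _).trans
              (mul_le_of_le_one_right (by positivity) (hzle _))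
        _ = n / T := by simp [div_eq_mul_inv]
    have h3 : I.weight e.2 * ∑ i, (θ • ((1 / T : ℝ) • z)) (i, e.2) ≤
        I.assignmentValue a * (n / T) :=
      mul_le_mul ((I.weight_le_assignmentValue hn e.2).trans (ha _)) h2
        (Finset.sum_nonneg fun i _ => mul_nonneg hθ0.le (mul_nonneg (by positivity) (hz0 _))) hW
    have h4 : 1 / T * z e * (multilinearExtension (slope I.welfare e) (y t) -
        I.assignmentValue a * (n / T)) ≤ 1 / T * z e *
          multilinearExtension (slope I.welfare e) (y t + θ • ((1 / T : ℝ) • z)) :=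
      mul_le_mul_of_nonneg_left (by linarith) (mul_nonneg (by positivity) (hz0 e))
    refine le_trans (le_of_eq ?_) h4
    field_simp
  have hsum := Finset.sum_le_sum fun e (_ : e ∈ Finset.univ) => hterm e
  rw [← h, Finset.sum_sub_distrib, ← Finset.mul_sum, ← Finset.sum_mul, hsumz, ← hyz] at hsum
  have h5 : 1 / (T : ℝ) * (I.assignmentValue a - multilinearExtension I.welfare (y t) +
      1 / n * ∑ e, y t e * multilinearExtension (slope I.welfare e) (y t)) ≤
      1 / T * ∑ e, z e * multilinearExtension (slope I.welfare e) (y t) :=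
    mul_le_mul_of_nonneg_left (by linarith) (by positivity)
  have h6 : (n : ℝ) ^ 2 * I.assignmentValue a / T ^ 2 =
      n * (n * I.assignmentValue a / T ^ 2) := by ring
  rw [h6]
  linarith

/-- In the beginning the iterates are small, so that the partial derivatives are large. -/
theorem MNLUniform.half_le_sum_mul_slope (I : MNLUniform n m) {T : ℕ}
    {y : ℕ → Fin n × Fin m → ℝ} (hy : IsContinuousGreedyRun I.welfare T y) {t : ℕ} (ht : t < T)
    (htn : 2 * n * t ≤ T) :
    multilinearExtension I.welfare (y t) / 2 ≤
      ∑ e, y t e * multilinearExtension (slope I.welfare e) (y t) := by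
  have hT : (0 : ℝ) < T := by exact_mod_cast (by omega : 0 < T)
  have h := I.multilinearExtension_le_sum_weight (hy.nonneg ht.le) (hy.le_one ht.le)
  have h2 : ∑ e, y t e * (I.weight e.2 / 2) ≤
      ∑ e, y t e * multilinearExtension (slope I.welfare e) (y t) := by
    refine Finset.sum_le_sum fun e _ => mul_le_mul_of_nonneg_left ?_ (hy.nonneg ht.le e)
    have h3 := I.multilinearExtension_slope_ge e (y := 0) (d := y t) (by simp)
      (hy.nonneg ht.le) (by simpa using hy.le_one ht.le)
    rw [I.multilinearExtension_slope_zero, zero_add] at h3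
    have h4 : ∑ i, y t (i, e.2) ≤ 1 / 2 := by
      calc ∑ i, y t (i, e.2) ≤ ∑ _i : Fin n, (t / T : ℝ) :=
            Finset.sum_le_sum fun i _ => hy.le_div ht.le _
        _ = n * t / T := by simp [mul_div_assoc]
        _ ≤ 1 / 2 := by
            rw [div_le_div_iff₀ hT (by norm_num)]
            have : 2 * (n : ℝ) * t ≤ T := by exact_mod_cast htn
            linarith
    have h5 := mul_le_mul_of_nonneg_left h4 (I.weight_nonneg e.2)
    linarith
  simp only [← mul_div_assoc, ← Finset.sum_div] at h2
  linarith

theorem MNLUniform.greedy_value (I : MNLUniform n m) (hn : 0 < n) {a : Fin n → Fin m}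
    (ha : ∀ b, I.assignmentValue b ≤ I.assignmentValue a) {T : ℕ} (hT : 1000 * n ^ 5 ≤ T)
    {y : ℕ → Fin n × Fin m → ℝ} (hy : IsContinuousGreedyRun I.welfare T y) :
    (1 - Real.exp (-1)) * I.assignmentValue a ≤ multilinearExtension I.welfare (y T) := by
  refine one_sub_exp_le_of_recursion (F := fun t => multilinearExtension I.welfare (y t)) hn hT
    (I.assignmentValue_nonneg a) ?_ ?_ ?_
  · simp only [hy.start]
    exact I.multilinearExtension_zero
  · intro t ht
    refine le_trans ?_ (I.greedy_step hn ha hy ht)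
    have h1 : 0 ≤ ∑ e, y t e * multilinearExtension (slope I.welfare e) (y t) :=
      Finset.sum_nonneg fun e _ => mul_nonneg (hy.nonneg ht.le e)
        (I.multilinearExtension_slope_nonneg e (hy.nonneg ht.le) (hy.le_one ht.le))
    gcongr
    have : 0 ≤ 1 / (n : ℝ) * ∑ e, y t e * multilinearExtension (slope I.welfare e) (y t) := by
      positivity
    linarith
  · intro t ht htn
    refine le_trans ?_ (I.greedy_step hn ha hy ht)
    have := I.half_le_sum_mul_slope hy ht htn
    gcongr

/-! ### Independent rounding -/

/-- The function depends only on the pairs (i, j) with i ∈ C; all other coordinates integrate out.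
The induction conditions on one consumer of `C` at a time. -/
theorem multilinearExtension_card_part (y : Fin n × Fin m → ℝ) (j : Fin m) (C : Finset (Fin n))
    (ψ : ℕ → ℝ) :
    multilinearExtension (fun A => ψ (part A j ∩ C).card) y =
      subsetSum C (fun B => ψ B.card) fun i => y (i, j) := by
  induction C using Finset.induction_on generalizing ψ with
  | empty => simp [multilinearExtension_const, subsetSum]
  | insert i C hi ih =>
    -- Since `i ∉ C`, the coordinate `(i, j)` is irrelevant here and may be dropped from the product
    -- measure.
    have hrec : ∀ χ : ℕ → ℝ, subsetSum (Finset.univ.erase (i, j))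
        (fun A => χ (part A j ∩ C).card) y = subsetSum C (fun B => χ B.card) fun i => y (i, j) := by
      intro χ
      rw [← ih χ, multilinearExtension_eq_erase (i, j)]
      have : (fun A : Finset (Fin n × Fin m) => χ (part (insert (i, j) A) j ∩ C).card) =
          fun A => χ (part A j ∩ C).card := by
        funext A
        congr 2
        ext i'
        simp only [part, Finset.mem_inter, Finset.mem_filter, Finset.mem_univ, true_and,
          Finset.mem_insert, Prod.mk.injEq, and_true]
        constructor
        · rintro ⟨rfl | h, h2⟩
          · exact absurd h2 hi
          · exact ⟨h, h2⟩
        · exact fun h => ⟨Or.inr h.1, h.2⟩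
      rw [this]
      ring
    rw [multilinearExtension_eq_erase (i, j), subsetSum_insert hi]
    congr 2
    · rw [← subsetSum_congr (C := C) (φ := fun B => ψ (B.card + 1)) (fun B hB => by
        rw [Finset.card_insert_of_notMem fun h => hi (hB h)]) fun _ _ => rfl,
        ← hrec fun k => ψ (k + 1)]
      refine subsetSum_congr (fun A hA => ?_) fun _ _ => rfl
      have hA' : (i, j) ∉ A := fun h => by simpa using hA h
      rw [← Finset.card_insert_of_notMem (s := part A j ∩ C) (a := i) fun h =>
        hi (Finset.mem_inter.1 h).2]
      congr 2
      ext i'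
      by_cases h : i' = i <;> simp [part, h]
    · rw [← hrec ψ]
      refine subsetSum_congr (fun A hA => ?_) fun _ _ => rfl
      have hA' : (i, j) ∉ A := fun h => by simpa using hA h
      congr 2
      ext i'
      by_cases h : i' = i <;> simp [part, h, hA']

/-- The events that consumer i goes to `j` are independent over i with probabilities `y (i, j)`. So
a single part has the same law as under the multilinear extension, although different parts are now
dependent. -/
theorem sum_prod_mul_card_partitionOf {y : Fin n × Fin m → ℝ} (hy : ∀ i, ∑ j, y (i, j) = 1)
    (j : Fin m) (ψ : ℕ → ℝ) :
    ∑ a : Fin n → Fin m, (∏ i, y (i, a i)) * ψ (partitionOf a j).card =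
      subsetSum Finset.univ (fun B => ψ B.card) fun i => y (i, j) := by
  rw [← Finset.sum_fiberwise Finset.univ (fun a : Fin n → Fin m => partitionOf a j)]
  unfold subsetSum
  rw [Finset.powerset_univ]
  refine Finset.sum_congr rfl fun B _ => ?_
  have h1 : (Finset.univ.filter fun a : Fin n → Fin m => partitionOf a j = B) =
      Fintype.piFinset fun i => if i ∈ B then {j} else Finset.univ.erase j := by
    ext a
    simp only [Finset.mem_filter, Finset.mem_univ, true_and, Fintype.mem_piFinset, Finset.ext_iff,
      partitionOf]
    refine forall_congr' fun i => ?_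
    by_cases h : i ∈ B <;> simp [h]
  rw [Finset.sum_congr rfl fun a ha => by rw [(Finset.mem_filter.1 ha).2], h1, ← Finset.sum_mul,
    ← Finset.prod_univ_sum (fun i => if i ∈ B then {j} else Finset.univ.erase j)
      fun i j => y (i, j), ← Finset.prod_sdiff (Finset.subset_univ B)]
  have h2 : ∏ i ∈ Finset.univ \ B, ∑ j' ∈ (if i ∈ B then {j} else Finset.univ.erase j), y (i, j') =
      ∏ i ∈ Finset.univ \ B, (1 - y (i, j)) := by
    refine Finset.prod_congr rfl fun i hi => ?_
    rw [if_neg (Finset.mem_sdiff.1 hi).2, ← hy i, Finset.sum_erase_eq_sub (Finset.mem_univ j)]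
  have h3 : ∏ i ∈ B, ∑ j' ∈ (if i ∈ B then {j} else Finset.univ.erase j), y (i, j') =
      ∏ i ∈ B, y (i, j) := by
    refine Finset.prod_congr rfl fun i hi => ?_
    rw [if_pos hi, Finset.sum_singleton]
  rw [h2, h3]
  ring

/-- Welfare is a sum over the suppliers, so only the law of each single part matters, not their
joint law. -/
theorem MNLUniform.sum_prod_mul_assignmentValue (I : MNLUniform n m) {y : Fin n × Fin m → ℝ}
    (hy : ∀ i, ∑ j, y (i, j) = 1) :
    ∑ a : Fin n → Fin m, (∏ i, y (i, a i)) * I.assignmentValue a =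
      multilinearExtension I.welfare y := by
  have h : I.welfare = fun A => ∑ j, I.r j * uniformDemand (I.u j) (part A j ∩ Finset.univ).card := by
    funext A
    simp [I.welfare_eq]
  simp only [h, multilinearExtension_sum, multilinearExtension_const_mul,
    multilinearExtension_card_part, ← sum_prod_mul_card_partitionOf hy, MNLUniform.assignmentValue,
    Finset.mul_sum]
  rw [Finset.sum_comm]
  refine Finset.sum_congr rfl fun j _ => Finset.sum_congr rfl fun a _ => by ring

/-! ### The expected revenue of a menu profile -/

theorem sum_prod_mul_apply {ι X : Type} [Fintype ι] [DecidableEq ι] [Fintype X]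
    {p : ι → X → ℝ} (hp : ∀ i, ∑ x, p i x = 1) (i : ι) (h : X → ℝ) :
    ∑ c : ι → X, (∏ k, p k (c k)) * h (c i) = ∑ x, p i x * h x := by
  have h1 : ∀ c : ι → X, (∏ k, p k (c k)) * h (c i) =
      ∏ k, p k (c k) * if k = i then h (c k) else 1 := by
    intro c
    rw [Finset.prod_mul_distrib, Finset.prod_ite_eq' Finset.univ i fun k => h (c k)]
    simp
  classical
  simp only [h1]
  rw [← Fintype.piFinset_univ, ← Finset.prod_univ_sum (fun _ => Finset.univ)
    fun k x => p k x * if k = i then h x else 1, Finset.prod_eq_single i]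
  · simp
  · intro k _ hk
    simp [hk, hp]
  · simp

theorem sum_prod_eq_one {ι X : Type} [Fintype ι] [DecidableEq ι] [Fintype X]
    {p : ι → X → ℝ} (hp : ∀ i, ∑ x, p i x = 1) : ∑ c : ι → X, ∏ k, p k (c k) = 1 := by
  classical
  rw [← Fintype.piFinset_univ, ← Finset.prod_univ_sum (fun _ => Finset.univ)]
  simp [hp]

theorem sum_mnlChoice {α : Type} [Fintype α] [DecidableEq α] {w : α → ℝ} (hw : ∀ x, 0 < w x)
    (S : Finset α) : ∑ x, mnlChoice w x S = 1 := by
  have h : 0 ≤ ∑ k ∈ S, w k := Finset.sum_nonneg fun k _ => (hw k).le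
  rw [Fintype.sum_option]
  simp only [mnlChoice, Finset.sum_ite_mem, Finset.univ_inter, ← Finset.sum_div]
  rw [← add_div, div_self (by positivity)]

theorem sum_uniformChoice {α : Type} [Fintype α] [DecidableEq α] {u : ℝ} (hu : 0 ≤ u)
    (S : Finset α) : ∑ x, uniformChoice u x S = 1 := by
  rw [Fintype.sum_option]
  simp only [uniformChoice, Finset.sum_ite_mem, Finset.univ_inter, Finset.sum_const, nsmul_eq_mul]
  split_ifs with h
  · simp [h]
  · have : 0 < S.card := Finset.card_pos.2 (Finset.nonempty_iff_ne_empty.2 h)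
    have : (0 : ℝ) < S.card := by exact_mod_cast this
    field_simp
    ring

/-- The revenue of supplier j depends on `d` only through `d j`, so the other suppliers' choices sum
to one. -/
theorem sum_prod_mul_matchingRevenue (r : Fin m → ℝ) (q : Fin m → ChoiceSystem (Fin n))
    (hq : ∀ j C, ∑ x, q j x C = 1) (c : Fin n → Option (Fin m)) :
    ∑ d : Fin m → Option (Fin n), (∏ j, q j (d j) (choosers c j)) * matchingRevenue r c d =
      ∑ j, r j * demand (q j) (choosers c j) := by
  simp only [matchingRevenue, Finset.mul_sum]
  rw [Finset.sum_comm]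
  refine Finset.sum_congr rfl fun j _ => ?_
  rw [sum_prod_mul_apply (p := fun j x => q j x (choosers c j)) (fun j => hq j _) j
    fun x => if ∃ i, c i = some j ∧ x = some i then r j else 0, Fintype.sum_option]
  simp only [reduceCtorEq, and_false, exists_false, if_false, mul_zero, zero_add,
    Option.some.injEq, exists_eq_right', mul_ite, demand, choosers, Finset.sum_filter,
    Finset.mul_sum]
  refine Finset.sum_congr rfl fun i _ => ?_
  rw [mul_comm]

theorem MNLUniform.revenue_eq (I : MNLUniform n m) (S : MenuProfile n m) :
    I.revenue S = ∑ c : Fin n → Option (Fin m), (∏ i, mnlChoice (I.v i) (c i) (S i)) *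
      ∑ j, I.r j * uniformDemand (I.u j) (choosers c j).card := by
  unfold MNLUniform.revenue expectedRevenue
  refine Finset.sum_congr rfl fun c _ => ?_
  rw [sum_prod_mul_matchingRevenue I.r I.supplierChoice fun j C => sum_uniformChoice (I.u_nonneg j) C]
  simp only [MNLUniform.supplierChoice, demand_uniformChoice]
  rfl

theorem mnlChoice_nonneg {α : Type} [DecidableEq α] {w : α → ℝ} (hw : ∀ x, 0 < w x)
    (x : Option α) (S : Finset α) : 0 ≤ mnlChoice w x S := by
  have h : 0 ≤ ∑ k ∈ S, w k := Finset.sum_nonneg fun k _ => (hw k).le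
  cases x with
  | none => simp only [mnlChoice]; positivity
  | some x =>
    have := (hw x).le
    simp only [mnlChoice]
    split_ifs <;> positivity

theorem MNLUniform.revenue_le (I : MNLUniform n m) (hm : 0 < m) {W : ℝ}
    (hW : ∀ a, I.assignmentValue a ≤ W) (S : MenuProfile n m) : I.revenue S ≤ W := by
  have hone := sum_prod_eq_one (p := fun i x => mnlChoice (I.v i) x (S i))
    fun i => sum_mnlChoice (I.v_pos i) (S i)
  rw [I.revenue_eq, ← one_mul W, ← hone, Finset.sum_mul]
  refine Finset.sum_le_sum fun c _ => mul_le_mul_of_nonneg_left ?_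
    (Finset.prod_nonneg fun i _ => mnlChoice_nonneg (I.v_pos i) _ _)
  -- Consumers who took the outside option go to an arbitrary supplier, which can only increase
  -- monotone demand.
  refine le_trans ?_ (hW fun i => (c i).getD ⟨0, hm⟩)
  refine Finset.sum_le_sum fun j _ => mul_le_mul_of_nonneg_left
    (uniformDemand_mono (I.u_nonneg j) (Finset.card_le_card fun i hi => ?_)) (I.r_nonneg j)
  simp only [choosers, partitionOf, Finset.mem_filter, Finset.mem_univ, true_and] at hi ⊢
  simp [hi]

theorem menusOf_partitionOf (a : Fin n → Fin m) (i : Fin n) :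
    menusOf (partitionOf a) i = {a i} := by
  ext j
  simp [menusOf, partitionOf, eq_comm]

theorem MNLUniform.half_assignmentValue_le (I : MNLUniform n m) (hv : ∀ i j, 1 ≤ I.v i j)
    (a : Fin n → Fin m) : I.assignmentValue a / 2 ≤ I.revenue (menusOf (partitionOf a)) := by
  rw [I.revenue_eq]
  simp only [menusOf_partitionOf, Finset.mul_sum]
  rw [Finset.sum_comm, MNLUniform.assignmentValue, Finset.sum_div]
  refine Finset.sum_le_sum fun j _ => ?_
  set k : ℝ := ((partitionOf a j).card : ℝ) + I.u j with hk
  have hk0 : 0 ≤ k := add_nonneg (Nat.cast_nonneg _) (I.u_nonneg j)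
  -- Replacing the random denominator |C_j| + u by the larger |A_j| + u makes the bound linear in
  -- the individual acceptances, so no joint distribution is needed. Profiles in which someone
  -- chooses outside the singleton menu have probability zero.
  have hlow : ∀ c : Fin n → Option (Fin m),
      ∑ i ∈ partitionOf a j, (∏ i, mnlChoice (I.v i) (c i) {a i}) *
        (I.r j * ((if c i = some j then 1 else 0) / k)) ≤
      (∏ i, mnlChoice (I.v i) (c i) {a i}) *
        (I.r j * uniformDemand (I.u j) (choosers c j).card) := by
    intro c
    by_cases hc : ∀ i, c i = none ∨ c i = some (a i)
    · rw [← Finset.mul_sum, ← Finset.mul_sum, ← Finset.sum_div]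
      refine mul_le_mul_of_nonneg_left (mul_le_mul_of_nonneg_left ?_ (I.r_nonneg j))
        (Finset.prod_nonneg fun i _ => mnlChoice_nonneg (I.v_pos i) _ _)
      have hsub : choosers c j ⊆ partitionOf a j := by
        intro i hi
        simp only [choosers, partitionOf, Finset.mem_filter, Finset.mem_univ, true_and] at hi ⊢
        rcases hc i with h | h <;> rw [h] at hi
        · simp at hi
        · simpa using hi
      have hcard : ∑ i ∈ partitionOf a j, (if c i = some j then (1 : ℝ) else 0) =
          (choosers c j).card := by
        rw [Finset.sum_boole]
        congr 2
        ext i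
        simp only [Finset.mem_filter, choosers, Finset.mem_univ, true_and, and_iff_right_iff_imp]
        intro hi
        exact hsub (by simpa [choosers] using hi)
      rw [hcard, uniformDemand]
      rcases (choosers c j).card.eq_zero_or_pos with h0 | h0
      · simp [h0]
      · have h0' : (0 : ℝ) < (choosers c j).card := by exact_mod_cast h0
        have hle : ((choosers c j).card : ℝ) ≤ (partitionOf a j).card := by
          exact_mod_cast Finset.card_le_card hsub
        have := I.u_nonneg j
        rw [hk]
        gcongr
    · push Not at hc
      obtain ⟨i, h1, h2⟩ := hc
      have hz : ∏ i, mnlChoice (I.v i) (c i) {a i} = 0 := by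
        refine Finset.prod_eq_zero (Finset.mem_univ i) ?_
        obtain ⟨x, hx⟩ := Option.ne_none_iff_exists'.1 h1
        rw [hx] at h2 ⊢
        have : x ≠ a i := fun h => h2 (by rw [h])
        simp [mnlChoice, this]
      simp [hz]
  refine le_trans ?_ (Finset.sum_le_sum fun c _ => hlow c)
  rw [Finset.sum_comm]
  have hterm : ∀ i ∈ partitionOf a j, I.r j / k * (1 / 2) ≤
      ∑ c : Fin n → Option (Fin m), (∏ i, mnlChoice (I.v i) (c i) {a i}) *
        (I.r j * ((if c i = some j then 1 else 0) / k)) := by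
    intro i hi
    have hai : a i = j := by simpa [partitionOf] using hi
    rw [sum_prod_mul_apply (p := fun i x => mnlChoice (I.v i) x {a i})
      (fun i => sum_mnlChoice (I.v_pos i) _) i
      fun x => I.r j * ((if x = some j then 1 else 0) / k),
      Finset.sum_eq_single (some j)]
    · simp only [mnlChoice, hai, Finset.mem_singleton, Finset.sum_singleton, if_true]
      have h1 := hv i j
      have h2 : (1 : ℝ) / 2 ≤ I.v i j / (1 + I.v i j) := by
        rw [div_le_div_iff₀ (by norm_num) (by linarith)]
        linarith
      have h3 : 0 ≤ I.r j / k := div_nonneg (I.r_nonneg j) hk0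
      calc I.r j / k * (1 / 2) ≤ I.r j / k * (I.v i j / (1 + I.v i j)) :=
            mul_le_mul_of_nonneg_left h2 h3
        _ = _ := by ring
    · intro x _ hx
      simp [hx]
    · simp
  refine le_trans ?_ (Finset.sum_le_sum hterm)
  rw [Finset.sum_const, nsmul_eq_mul, uniformDemand]
  exact le_of_eq (by ring)

/-! ### The approximation guarantee -/

theorem sum_algorithmLaw_mul (y : Fin n × Fin m → ℝ) (R : MenuProfile n m → ℝ) :
    ∑ S, algorithmLaw y S * R S =
      ∑ a : Fin n → Fin m, (∏ i, y (i, a i)) * R (menusOf (partitionOf a)) := by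
  simp only [algorithmLaw, Finset.sum_mul, ite_mul, zero_mul]
  rw [Finset.sum_comm]
  refine Finset.sum_congr rfl fun a _ => ?_
  rw [Finset.sum_ite_eq]
  simp

/-- The optimum is bounded over all menu profiles and the output consists of singletons, so
containing the singleton profiles is all that is required of the feasible set. -/
theorem MNLUniform.achieves_of_run (I : MNLUniform n m) (hm : 0 < m) (hv : ∀ i j, 1 ≤ I.v i j)
    {T : ℕ} (hT0 : 0 < T) (hT : 1000 * n ^ 5 ≤ T) {y : ℕ → Fin n × Fin m → ℝ}
    (hy : IsContinuousGreedyRun I.welfare T y) (feasible : Set (MenuProfile n m))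
    (hf : ∀ a : Fin n → Fin m, menusOf (partitionOf a) ∈ feasible) :
    I.Achieves ((1 - Real.exp (-1)) / 2) feasible (algorithmLaw (y T)) := by
  have hne : Nonempty (Fin n → Fin m) := ⟨fun _ => ⟨0, hm⟩⟩
  obtain ⟨a, ha⟩ := Finite.exists_max I.assignmentValue
  have hT0' : (T : ℝ) ≠ 0 := by exact_mod_cast hT0.ne'
  constructor
  · intro S hS
    obtain ⟨b, -, hb⟩ := Finset.exists_ne_zero_of_sum_ne_zero hS
    by_cases h : menusOf (partitionOf b) = S
    · exact h ▸ hf b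
    · simp [h] at hb
  · have hopt : I.opt feasible ≤ I.assignmentValue a := by
      refine Real.sSup_le ?_ (I.assignmentValue_nonneg a)
      rintro _ ⟨S, -, rfl⟩
      exact I.revenue_le hm ha S
    have he : 0 ≤ 1 - Real.exp (-1) := by
      rw [sub_nonneg]
      exact Real.exp_le_one_iff.2 (by norm_num)
    have hF : (1 - Real.exp (-1)) * I.assignmentValue a ≤ multilinearExtension I.welfare (y T) := by
      rcases n.eq_zero_or_pos with rfl | hn
      · have h0 : I.assignmentValue a = 0 := by
          simp [MNLUniform.assignmentValue, partitionOf, uniformDemand_zero]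
        have hy0 : y T = 0 := Subsingleton.elim _ _
        rw [h0, hy0, I.multilinearExtension_zero, mul_zero]
      · exact I.greedy_value hn ha hT hy
    rw [sum_algorithmLaw_mul]
    have hsum := I.sum_prod_mul_assignmentValue (y := y T) fun i => by
      rw [hy.row_sum le_rfl, div_self hT0']
    calc (1 - Real.exp (-1)) / 2 * I.opt feasible
        ≤ (1 - Real.exp (-1)) / 2 * I.assignmentValue a :=
          mul_le_mul_of_nonneg_left hopt (by linarith)
      _ ≤ multilinearExtension I.welfare (y T) / 2 := by linarith
      _ = ∑ b : Fin n → Fin m, (∏ i, y T (i, b i)) * (I.assignmentValue b / 2) := by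
          rw [← hsum, Finset.sum_div]
          exact Finset.sum_congr rfl fun b _ => by ring
      _ ≤ _ := Finset.sum_le_sum fun b _ => mul_le_mul_of_nonneg_left
          (I.half_assignmentValue_le hv b) (Finset.prod_nonneg fun i _ => hy.nonneg le_rfl _)

/-! ### Reasoning about programs -/

namespace Memory

variable (s : Memory)

@[simp] theorem nreg_tick : s.tick.nreg = s.nreg := rfl
@[simp] theorem rreg_tick : s.tick.rreg = s.rreg := rfl
@[simp] theorem narr_tick : s.tick.narr = s.narr := rfl
@[simp] theorem rarr_tick : s.tick.rarr = s.rarr := rfl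
@[simp] theorem time_tick : s.tick.time = s.time + 1 := rfl
@[simp] theorem nreg_setN (x k y : ℕ) :
    (s.setN x k).nreg y = if y = x then k else s.nreg y := by
  simp [setN, Function.update_apply]
@[simp] theorem rreg_setN (x k : ℕ) : (s.setN x k).rreg = s.rreg := rfl
@[simp] theorem narr_setN (x k : ℕ) : (s.setN x k).narr = s.narr := rfl
@[simp] theorem rarr_setN (x k : ℕ) : (s.setN x k).rarr = s.rarr := rfl
@[simp] theorem time_setN (x k : ℕ) : (s.setN x k).time = s.time := rfl
@[simp] theorem rreg_setR (x : ℕ) (k : ℝ) (y : ℕ) :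
    (s.setR x k).rreg y = if y = x then k else s.rreg y := by
  simp [setR, Function.update_apply]
@[simp] theorem nreg_setR (x : ℕ) (k : ℝ) : (s.setR x k).nreg = s.nreg := rfl
@[simp] theorem narr_setR (x : ℕ) (k : ℝ) : (s.setR x k).narr = s.narr := rfl
@[simp] theorem rarr_setR (x : ℕ) (k : ℝ) : (s.setR x k).rarr = s.rarr := rfl
@[simp] theorem narr_storeN (a i j k b i' j' : ℕ) :
    (s.storeN a i j k).narr b i' j' = if b = a ∧ i' = i ∧ j' = j then k else s.narr b i' j' := by
  simp only [storeN, Function.update_apply]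
  by_cases h1 : b = a <;> by_cases h2 : i' = i <;> by_cases h3 : j' = j <;>
    simp [h1, h2, h3]
@[simp] theorem nreg_storeN (a i j k : ℕ) : (s.storeN a i j k).nreg = s.nreg := rfl
@[simp] theorem rreg_storeN (a i j k : ℕ) : (s.storeN a i j k).rreg = s.rreg := rfl
@[simp] theorem rarr_storeN (a i j k : ℕ) : (s.storeN a i j k).rarr = s.rarr := rfl
@[simp] theorem rarr_storeR (a i j : ℕ) (k : ℝ) (b i' j' : ℕ) :
    (s.storeR a i j k).rarr b i' j' = if b = a ∧ i' = i ∧ j' = j then k else s.rarr b i' j' := by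
  simp only [storeR, Function.update_apply]
  by_cases h1 : b = a <;> by_cases h2 : i' = i <;> by_cases h3 : j' = j <;>
    simp [h1, h2, h3]
@[simp] theorem nreg_storeR (a i j : ℕ) (k : ℝ) : (s.storeR a i j k).nreg = s.nreg := rfl
@[simp] theorem rreg_storeR (a i j : ℕ) (k : ℝ) : (s.storeR a i j k).rreg = s.rreg := rfl
@[simp] theorem narr_storeR (a i j : ℕ) (k : ℝ) : (s.storeR a i j k).narr = s.narr := rfl

end Memory

/-- Every possible memory after running `P` from `s` satisfies `Q`. -/
def Ensures (P : Program) (s : Memory) (Q : Memory → Prop) : Prop := ∀ s' ∈ (P.exec s).support, Q s'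

section Rules

variable {s : Memory} {Q : Memory → Prop}

@[simp] theorem ensures_nconst {x k : ℕ} :
    Ensures (.nconst x k) s Q ↔ Q (s.tick.setN x k) := by simp [Ensures, Program.exec]
@[simp] theorem ensures_nadd {x y z : ℕ} :
    Ensures (.nadd x y z) s Q ↔ Q (s.tick.setN x (s.nreg y + s.nreg z)) := by
  simp [Ensures, Program.exec]
@[simp] theorem ensures_nload {x a i j : ℕ} :
    Ensures (.nload x a i j) s Q ↔ Q (s.tick.setN x (s.narr a (s.nreg i) (s.nreg j))) := by
  simp [Ensures, Program.exec]
@[simp] theorem ensures_nstore {a i j x : ℕ} :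
    Ensures (.nstore a i j x) s Q ↔ Q (s.tick.storeN a (s.nreg i) (s.nreg j) (s.nreg x)) := by
  simp [Ensures, Program.exec]
@[simp] theorem ensures_rconst {x k : ℕ} :
    Ensures (.rconst x k) s Q ↔ Q (s.tick.setR x k) := by simp [Ensures, Program.exec]
@[simp] theorem ensures_rcast {x y : ℕ} :
    Ensures (.rcast x y) s Q ↔ Q (s.tick.setR x (s.nreg y)) := by simp [Ensures, Program.exec]
@[simp] theorem ensures_rop {op : ArithOp} {x y z : ℕ} :
    Ensures (.rop op x y z) s Q ↔ Q (s.tick.setR x (op.eval (s.rreg y) (s.rreg z))) := by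
  simp [Ensures, Program.exec]
@[simp] theorem ensures_rload {x a i j : ℕ} :
    Ensures (.rload x a i j) s Q ↔ Q (s.tick.setR x (s.rarr a (s.nreg i) (s.nreg j))) := by
  simp [Ensures, Program.exec]
@[simp] theorem ensures_rstore {a i j x : ℕ} :
    Ensures (.rstore a i j x) s Q ↔ Q (s.tick.storeR a (s.nreg i) (s.nreg j) (s.rreg x)) := by
  simp [Ensures, Program.exec]

theorem ensures_rand {x y : ℕ} (h : ∀ d, Q (s.tick.setN x d)) : Ensures (.rand x y) s Q := by
  intro s' hs'
  unfold Program.exec at hs'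
  split at hs'
  · rw [PMF.support_pure, Set.mem_singleton_iff] at hs'
    exact hs' ▸ h 0
  · obtain ⟨d, -, rfl⟩ := (PMF.mem_support_map_iff _ _ _).1 hs'
    exact h d

@[simp] theorem ensures_seq {P P' : Program} :
    Ensures (.seq P P') s Q ↔ Ensures P s fun s' => Ensures P' s' Q := by
  simp only [Ensures, Program.exec, PMF.mem_support_bind_iff]
  constructor
  · exact fun h s' hs' s'' hs'' => h s'' ⟨s', hs', hs''⟩
  · rintro h s'' ⟨s', hs', hs''⟩
    exact h s' hs' s'' hs''

@[simp] theorem ensures_ifN {x y : ℕ} {P P' : Program} : Ensures (.ifN x y P P') s Q ↔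
    if s.nreg x < s.nreg y then Ensures P s.tick Q else Ensures P' s.tick Q := by
  simp only [Ensures, Program.exec]
  split_ifs <;> rfl

@[simp] theorem ensures_ifR {x y : ℕ} {P P' : Program} : Ensures (.ifR x y P P') s Q ↔
    if s.rreg x < s.rreg y then Ensures P s.tick Q else Ensures P' s.tick Q := by
  simp only [Ensures, Program.exec]
  split_ifs <;> rfl

theorem Ensures.mono {P : Program} {Q' : Memory → Prop} (h : Ensures P s Q)
    (hQ : ∀ s', Q s' → Q' s') : Ensures P s Q' := fun s' hs' => hQ s' (h s' hs')

theorem Ensures.and {P : Program} {Q' : Memory → Prop} (h : Ensures P s Q) (h' : Ensures P s Q') :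
    Ensures P s fun s' => Q s' ∧ Q' s' := fun s' hs' => ⟨h s' hs', h' s' hs'⟩

/-- The law of the memory after `k` iterations of a loop. -/
def iterLaw (x : ℕ) (P : Program) (s : Memory) (k : ℕ) : PMF Memory :=
  (List.range k).foldl (fun law k => law.bind fun s' => P.exec (s'.tick.setN x k)) (PMF.pure s.tick)

theorem iterLaw_zero (x : ℕ) (P : Program) (s : Memory) : iterLaw x P s 0 = PMF.pure s.tick := rfl

theorem iterLaw_succ (x : ℕ) (P : Program) (s : Memory) (k : ℕ) :
    iterLaw x P s (k + 1) = (iterLaw x P s k).bind fun s' => P.exec (s'.tick.setN x k) := by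
  simp [iterLaw, List.range_succ]

theorem exec_loop (x y : ℕ) (P : Program) (s : Memory) :
    (Program.loop x y P).exec s = iterLaw x P s (s.nreg y) := rfl

theorem ensures_loop {x y : ℕ} {P : Program} (Inv : ℕ → Memory → Prop) (h0 : Inv 0 s.tick)
    (hs : ∀ k < s.nreg y, ∀ s', Inv k s' → Ensures P (s'.tick.setN x k) (Inv (k + 1))) :
    Ensures (.loop x y P) s (Inv (s.nreg y)) := by
  have key : ∀ k ≤ s.nreg y, ∀ s' ∈ (iterLaw x P s k).support, Inv k s' := by
    intro k
    induction k with
    | zero =>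
      intro _ s' hs'
      rw [iterLaw_zero, PMF.support_pure, Set.mem_singleton_iff] at hs'
      exact hs' ▸ h0
    | succ k ih =>
      intro hk s'' hs''
      rw [iterLaw_succ, PMF.mem_support_bind_iff] at hs''
      obtain ⟨s', hs', hs''⟩ := hs''
      exact hs k (by omega) s' (ih (by omega) s' hs') s'' hs''
  exact key _ le_rfl

end Rules

/-! ### Frames -/

namespace Program

/-- The natural registers that a program writes. -/
def wN : Program → List ℕ
  | nconst x _ => [x]
  | nadd x _ _ => [x]
  | nload x _ _ _ => [x]
  | rand x _ => [x]
  | seq P Q => P.wN ++ Q.wN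
  | ifN _ _ P Q => P.wN ++ Q.wN
  | ifR _ _ P Q => P.wN ++ Q.wN
  | loop x _ P => x :: P.wN
  | _ => []

/-- The real registers that a program writes. -/
def wR : Program → List ℕ
  | rconst x _ => [x]
  | rcast x _ => [x]
  | rop _ x _ _ => [x]
  | rload x _ _ _ => [x]
  | seq P Q => P.wR ++ Q.wR
  | ifN _ _ P Q => P.wR ++ Q.wR
  | ifR _ _ P Q => P.wR ++ Q.wR
  | loop _ _ P => P.wR
  | _ => []

/-- The natural arrays that a program writes. -/
def wNA : Program → List ℕ
  | nstore a _ _ _ => [a]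
  | seq P Q => P.wNA ++ Q.wNA
  | ifN _ _ P Q => P.wNA ++ Q.wNA
  | ifR _ _ P Q => P.wNA ++ Q.wNA
  | loop _ _ P => P.wNA
  | _ => []

/-- The real arrays that a program writes. -/
def wRA : Program → List ℕ
  | rstore a _ _ _ => [a]
  | seq P Q => P.wRA ++ Q.wRA
  | ifN _ _ P Q => P.wRA ++ Q.wRA
  | ifR _ _ P Q => P.wRA ++ Q.wRA
  | loop _ _ P => P.wRA
  | _ => []

/-- The registers that a program uses as loop bounds. -/
def bounds : Program → List ℕ
  | seq P Q => P.bounds ++ Q.bounds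
  | ifN _ _ P Q => P.bounds ++ Q.bounds
  | ifR _ _ P Q => P.bounds ++ Q.bounds
  | loop _ y P => y :: P.bounds
  | _ => []

/-- A bound for the number of steps of a program whose loops have at most `N` iterations. -/
def cost (N : ℕ) : Program → ℕ
  | seq P Q => P.cost N + Q.cost N
  | ifN _ _ P Q => 1 + P.cost N + Q.cost N
  | ifR _ _ P Q => 1 + P.cost N + Q.cost N
  | loop _ _ P => 1 + N * (1 + P.cost N)
  | _ => 1

end Program

/-- The memory `s'` agrees with `s` wherever `P` does not write. -/
structure Frame (P : Program) (s s' : Memory) : Prop where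
  nreg : ∀ x ∉ P.wN, s'.nreg x = s.nreg x
  rreg : ∀ x ∉ P.wR, s'.rreg x = s.rreg x
  narr : ∀ a ∉ P.wNA, s'.narr a = s.narr a
  rarr : ∀ a ∉ P.wRA, s'.rarr a = s.rarr a

theorem Frame.mono {P P' : Program} {s s' t t' : Memory} (h : Frame P s s')
    (hN : P.wN ⊆ P'.wN) (hR : P.wR ⊆ P'.wR) (hNA : P.wNA ⊆ P'.wNA) (hRA : P.wRA ⊆ P'.wRA)
    (h1 : Frame P' t s) (h2 : Frame P' s' t') : Frame P' t t' where
  nreg x hx := by rw [h2.nreg x hx, h.nreg x fun h => hx (hN h), h1.nreg x hx]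
  rreg x hx := by rw [h2.rreg x hx, h.rreg x fun h => hx (hR h), h1.rreg x hx]
  narr x hx := by rw [h2.narr x hx, h.narr x fun h => hx (hNA h), h1.narr x hx]
  rarr x hx := by rw [h2.rarr x hx, h.rarr x fun h => hx (hRA h), h1.rarr x hx]

theorem Frame.tick {P : Program} {s : Memory} : Frame P s s.tick :=
  ⟨fun _ _ => rfl, fun _ _ => rfl, fun _ _ => rfl, fun _ _ => rfl⟩

theorem Frame.refl {P : Program} {s : Memory} : Frame P s s :=
  ⟨fun _ _ => rfl, fun _ _ => rfl, fun _ _ => rfl, fun _ _ => rfl⟩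

theorem Frame.trans {P : Program} {s s' s'' : Memory} (h : Frame P s s') (h' : Frame P s' s'') :
    Frame P s s'' := h.mono (List.Subset.refl _) (List.Subset.refl _) (List.Subset.refl _)
      (List.Subset.refl _) .refl h'

theorem frame_loop_tick {x y k : ℕ} {P : Program} {s : Memory} :
    Frame (.loop x y P) s (s.tick.setN x k) where
  nreg z hz := by
    have : z ≠ x := fun h => hz (by simp [Program.wN, h])
    simp [this]
  rreg _ _ := rfl
  narr _ _ := rfl
  rarr _ _ := rfl

/-- With this, preservation of a register or array reduces to non-membership in a list, which for
concrete programs is settled by `decide` or `simp`. -/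
theorem ensures_frame (P : Program) (s : Memory) : Ensures P s (Frame P s) := by
  induction P generalizing s with
  | rand x y =>
    refine ensures_rand fun d => ⟨fun z hz => ?_, fun _ _ => rfl, fun _ _ => rfl, fun _ _ => rfl⟩
    simp only [Program.wN, List.mem_singleton] at hz
    simp [hz]
  | seq P Q ihP ihQ =>
    rw [ensures_seq]
    refine (ihP s).mono fun s' h => (ihQ s').mono fun s'' h' => ?_
    refine h.mono (by simp [Program.wN]) (by simp [Program.wR]) (by simp [Program.wNA])
      (by simp [Program.wRA]) .refl ?_
    exact h'.mono (by simp [Program.wN]) (by simp [Program.wR]) (by simp [Program.wNA])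
      (by simp [Program.wRA]) .refl .refl
  | ifN x y P Q ihP ihQ =>
    rw [ensures_ifN]
    split_ifs
    · exact (ihP s.tick).mono fun s' h => h.mono (by simp [Program.wN]) (by simp [Program.wR])
        (by simp [Program.wNA]) (by simp [Program.wRA]) .tick .refl
    · exact (ihQ s.tick).mono fun s' h => h.mono (by simp [Program.wN]) (by simp [Program.wR])
        (by simp [Program.wNA]) (by simp [Program.wRA]) .tick .refl
  | ifR x y P Q ihP ihQ =>
    rw [ensures_ifR]
    split_ifs
    · exact (ihP s.tick).mono fun s' h => h.mono (by simp [Program.wN]) (by simp [Program.wR])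
        (by simp [Program.wNA]) (by simp [Program.wRA]) .tick .refl
    · exact (ihQ s.tick).mono fun s' h => h.mono (by simp [Program.wN]) (by simp [Program.wR])
        (by simp [Program.wNA]) (by simp [Program.wRA]) .tick .refl
  | loop x y P ih =>
    refine ensures_loop (fun _ s' => Frame (.loop x y P) s s') .tick fun k _ s' hs' => ?_
    exact (ih _).mono fun s'' h => h.mono (by simp [Program.wN]) (by simp [Program.wR])
      (by simp [Program.wNA]) (by simp [Program.wRA]) (hs'.trans frame_loop_tick) .refl
  | nconst x k =>
    refine ensures_nconst.2 ⟨fun z hz => ?_, fun _ _ => rfl, fun _ _ => rfl, fun _ _ => rfl⟩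
    simp only [Program.wN, List.mem_singleton] at hz
    simp [hz]
  | nadd x y z =>
    refine ensures_nadd.2 ⟨fun z hz => ?_, fun _ _ => rfl, fun _ _ => rfl, fun _ _ => rfl⟩
    simp only [Program.wN, List.mem_singleton] at hz
    simp [hz]
  | nload x a i j =>
    refine ensures_nload.2 ⟨fun z hz => ?_, fun _ _ => rfl, fun _ _ => rfl, fun _ _ => rfl⟩
    simp only [Program.wN, List.mem_singleton] at hz
    simp [hz]
  | nstore a i j x =>
    refine ensures_nstore.2 ⟨fun _ _ => rfl, fun _ _ => rfl, fun z hz => ?_, fun _ _ => rfl⟩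
    simp only [Program.wNA, List.mem_singleton] at hz
    funext i' j'
    simp [hz]
  | rconst x k =>
    refine ensures_rconst.2 ⟨fun _ _ => rfl, fun z hz => ?_, fun _ _ => rfl, fun _ _ => rfl⟩
    simp only [Program.wR, List.mem_singleton] at hz
    simp [hz]
  | rcast x y =>
    refine ensures_rcast.2 ⟨fun _ _ => rfl, fun z hz => ?_, fun _ _ => rfl, fun _ _ => rfl⟩
    simp only [Program.wR, List.mem_singleton] at hz
    simp [hz]
  | rop op x y z =>
    refine ensures_rop.2 ⟨fun _ _ => rfl, fun z hz => ?_, fun _ _ => rfl, fun _ _ => rfl⟩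
    simp only [Program.wR, List.mem_singleton] at hz
    simp [hz]
  | rload x a i j =>
    refine ensures_rload.2 ⟨fun _ _ => rfl, fun z hz => ?_, fun _ _ => rfl, fun _ _ => rfl⟩
    simp only [Program.wR, List.mem_singleton] at hz
    simp [hz]
  | rstore a i j x =>
    refine ensures_rstore.2 ⟨fun _ _ => rfl, fun _ _ => rfl, fun _ _ => rfl, fun z hz => ?_⟩
    simp only [Program.wRA, List.mem_singleton] at hz
    funext i' j'
    simp [hz]

theorem ensures_seq_of {P P' : Program} {s : Memory} {Q R : Memory → Prop} (h : Ensures P s R)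
    (h' : ∀ s', R s' → Frame P s s' → Ensures P' s' Q) : Ensures (.seq P P') s Q :=
  ensures_seq.2 ((h.and (ensures_frame P s)).mono fun s' hs' => h' s' hs'.1 hs'.2)

/-- The loop rule, with the frame as part of the invariant. -/
theorem ensures_loop_frame {x y : ℕ} {P : Program} {s : Memory} (Inv : ℕ → Memory → Prop)
    (h0 : Inv 0 s.tick)
    (hs : ∀ k < s.nreg y, ∀ s', Frame (.loop x y P) s s' → Inv k s' →
      Ensures P (s'.tick.setN x k) (Inv (k + 1))) :
    Ensures (.loop x y P) s (Inv (s.nreg y)) := by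
  refine (ensures_loop (fun k s' => Inv k s' ∧ Frame (.loop x y P) s s') ⟨h0, .tick⟩
    fun k hk s' hs' => ?_).mono fun _ h => h.1
  refine (hs k hk s' hs'.2 hs'.1).and ((ensures_frame P _).mono fun s'' h => ?_)
  exact h.mono (by simp [Program.wN]) (by simp [Program.wR])
    (by simp [Program.wNA]) (by simp [Program.wRA]) (hs'.2.trans frame_loop_tick) .refl

/-- The registers in `R` include all loop bounds and are never written, so their initial values
bound the iteration counts throughout. -/
theorem ensures_time {R : List ℕ} {N : ℕ} (P : Program) (s : Memory) (hw : ∀ y ∈ R, y ∉ P.wN)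
    (hb : P.bounds ⊆ R) (hN : ∀ y ∈ R, s.nreg y ≤ N) :
    Ensures P s fun s' => s'.time ≤ s.time + P.cost N := by
  induction P generalizing s with
  | rand x y => exact ensures_rand fun d => le_rfl
  | seq P Q ihP ihQ =>
    simp only [Program.wN, Program.bounds, List.mem_append, not_or, List.append_subset] at hw hb
    refine ensures_seq_of (ihP s (fun y hy => (hw y hy).1) hb.1 hN) fun s' h1 h2 => ?_
    refine (ihQ s' (fun y hy => (hw y hy).2) hb.2 fun y hy => ?_).mono fun s'' h3 => ?_
    · rw [h2.nreg y (hw y hy).1]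
      exact hN y hy
    · simp only [Program.cost]
      omega
  | ifN x y P Q ihP ihQ =>
    simp only [Program.wN, Program.bounds, List.mem_append, not_or, List.append_subset] at hw hb
    rw [ensures_ifN]
    split_ifs
    · refine (ihP s.tick (fun y hy => (hw y hy).1) hb.1 hN).mono fun s' h => ?_
      simp only [Program.cost, Memory.time_tick] at h ⊢
      omega
    · refine (ihQ s.tick (fun y hy => (hw y hy).2) hb.2 hN).mono fun s' h => ?_
      simp only [Program.cost, Memory.time_tick] at h ⊢
      omega
  | ifR x y P Q ihP ihQ =>
    simp only [Program.wN, Program.bounds, List.mem_append, not_or, List.append_subset] at hw hb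
    rw [ensures_ifR]
    split_ifs
    · refine (ihP s.tick (fun y hy => (hw y hy).1) hb.1 hN).mono fun s' h => ?_
      simp only [Program.cost, Memory.time_tick] at h ⊢
      omega
    · refine (ihQ s.tick (fun y hy => (hw y hy).2) hb.2 hN).mono fun s' h => ?_
      simp only [Program.cost, Memory.time_tick] at h ⊢
      omega
  | loop x y P ih =>
    have hy : y ∈ R := hb (by simp [Program.bounds])
    refine (ensures_loop_frame (fun k s' => s'.time ≤ s.time + 1 + k * (1 + P.cost N)) (by simp)
      fun k hk s' hF h => ?_).mono fun s' h => ?_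
    · refine (ih (s'.tick.setN x k) (fun y hy h => hw y hy (by simp [Program.wN, h]))
        (fun z hz => hb (by simp [Program.bounds, hz])) fun z hz => ?_).mono fun s'' h' => ?_
      · have hzx : z ≠ x := fun h => hw z hz (by simp [Program.wN, h])
        simp only [Memory.nreg_setN, Memory.nreg_tick, if_neg hzx]
        rw [hF.nreg z (hw z hz)]
        exact hN z hz
      · simp only [Memory.time_setN, Memory.time_tick] at h'
        rw [Nat.succ_mul]
        omega
    · have := Nat.mul_le_mul_right (1 + P.cost N) (hN y hy)
      simp only [Program.cost]
      omega
  | nconst x k => exact ensures_nconst.2 le_rfl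
  | nadd x y z => exact ensures_nadd.2 le_rfl
  | nload x a i j => exact ensures_nload.2 le_rfl
  | nstore a i j x => exact ensures_nstore.2 le_rfl
  | rconst x k => exact ensures_rconst.2 le_rfl
  | rcast x y => exact ensures_rcast.2 le_rfl
  | rop op x y z => exact ensures_rop.2 le_rfl
  | rload x a i j => exact ensures_rload.2 le_rfl
  | rstore a i j x => exact ensures_rstore.2 le_rfl

/-! ### The symmetric continuous greedy algorithm -/

/-- De Casteljau's scheme: `bernstein v x l k` is the expectation of `v (k + B)` for a binomial
variable `B` with parameters `l` and `x`. -/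
def bernstein (v : ℕ → ℝ) (x : ℝ) : ℕ → ℕ → ℝ
  | 0, k => v k
  | l + 1, k => (1 - x) * bernstein v x l k + x * bernstein v x l (k + 1)

/-- The partial derivative for a supplier with revenue `r` and outside score `u` to which each of `n`
consumers is assigned with probability `x`. -/
def symmetricGain (r u x : ℝ) : ℕ → ℝ
  | 0 => 0
  | l + 1 => bernstein (fun k => r * uniformGain u k) x l 0

/-- The position and the value of the first maximum of `g` on `{0, …, k - 1}`, for `g ≥ 0`. -/
def scan (g : ℕ → ℝ) : ℕ → ℕ × ℝ
  | 0 => (0, 0)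
  | k + 1 => if (scan g k).2 < g k then (k, g k) else scan g k

/-- The supplier chosen by the symmetric greedy algorithm at the point `x`. -/
def symmetricChoice (n m : ℕ) (r u x : ℕ → ℝ) : ℕ :=
  (scan (fun j => symmetricGain (r j) (u j) (x j) n) m).1

/-- The iterates of the symmetric greedy algorithm. -/
def symmetricPoint (n m T : ℕ) (r u : ℕ → ℝ) : ℕ → ℕ → ℝ
  | 0 => fun _ => 0
  | t + 1 => Function.update (symmetricPoint n m T r u t)
      (symmetricChoice n m r u (symmetricPoint n m T r u t))
      (symmetricPoint n m T r u t (symmetricChoice n m r u (symmetricPoint n m T r u t)) + 1 / T)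

/-! ### The program -/

namespace Program

/-- Compute the increments of the demand of the current supplier. -/
def fillIncrements : Program :=
  -- Real registers 6 and 7 hold the revenue and the outside score of the current supplier, 1 the
  -- constant 1. Real array 3 is the triangle of de Casteljau's scheme, and this loop fills its row
  -- 0.
  .loop 14 0 (.seq (.rcast 8 14) (.seq (.rop .add 9 8 7) (.seq (.rop .div 10 8 9)
    (.seq (.rop .add 8 8 1) (.seq (.rop .add 9 8 7) (.seq (.rop .div 11 8 9)
      (.seq (.rop .sub 10 11 10) (.seq (.rop .mul 10 6 10) (.rstore 3 9 14 10)))))))))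

/-- One row of de Casteljau's scheme. -/
def casteljauRow : Program :=
  .loop 17 0 (.seq (.nadd 18 17 10) (.seq (.rload 13 3 15 17) (.seq (.rload 14 3 15 18)
    (.seq (.rop .mul 13 5 13) (.seq (.rop .mul 14 4 14) (.seq (.rop .add 13 13 14)
      (.rstore 3 16 17 13)))))))

/-- De Casteljau's scheme. -/
def casteljau : Program :=
  .loop 15 0 (.seq (.rload 12 3 15 9) (.seq (.nadd 16 15 10) casteljauRow))

/-- Compute the partial derivative for the current supplier. -/
def computeGain : Program :=
  .seq (.rload 4 2 13 9) (.seq (.rop .sub 5 1 4) (.seq (.rload 6 0 13 9) (.seq (.rload 7 1 13 9)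
    (.seq fillIncrements (.seq (.rconst 12 0) casteljau)))))

/-- Find the best supplier. -/
def findBest : Program :=
  .loop 13 1 (.seq computeGain
    -- Natural register 9 and real register 15 hold 0, so the two additions are copies; writing
    -- register 19 serves as an empty branch.
    (.ifR 3 12 (.seq (.nadd 12 13 9) (.rop .add 3 12 15)) (.nconst 19 0)))

/-- One step of the greedy algorithm. -/
def greedyStep : Program :=
  -- Natural array 1 logs the supplier chosen in each step, for the rounding; real array 2 holds the
  -- common row of the current point.
  .seq (.nconst 12 0) (.seq (.rconst 3 0) (.seq findBest (.seq (.nstore 1 11 9 12)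
    (.seq (.rload 16 2 12 9) (.seq (.rop .add 16 16 2) (.rstore 2 12 9 16))))))

/-- The greedy algorithm. -/
def greedy : Program := .loop 11 2 greedyStep

/-- The assignment of one consumer. -/
def assign : Program := .seq (.rand 21 2) (.seq (.nload 22 1 21 9) (.nstore 0 20 22 10))

/-- The rounding step. -/
def rounding : Program := .loop 20 0 assign

/-- Prepare the registers for the computation of the number of steps. -/
def prepare (b : ℕ) : Program :=
  .seq (.nconst 10 1) (.seq (.nadd 3 0 1) (.seq (.nadd 3 3 10) (.seq (.nconst 4 b) (.nconst 2 b))))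

/-- Multiply the natural register `2` by the natural register `3`. -/
def multiply : Program :=
  .seq (.nconst 5 0) (.seq (.loop 7 3 (.nadd 5 5 2)) (.nadd 2 5 9))

/-- Compute the number of steps and the step size. -/
def stepSize : Program :=
  .seq (.loop 6 4 multiply) (.seq (.rcast 0 2) (.seq (.rconst 1 1) (.rop .div 2 1 0)))

end Program

/-- The values that the greedy algorithm reads. -/
structure Ready (n m T : ℕ) (r u : ℕ → ℝ) (s : Memory) : Prop where
  nreg_zero : s.nreg 0 = n
  nreg_one : s.nreg 1 = m
  nreg_two : s.nreg 2 = T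
  nreg_nine : s.nreg 9 = 0
  nreg_ten : s.nreg 10 = 1
  rreg_one : s.rreg 1 = 1
  rreg_two : s.rreg 2 = 1 / T
  rreg_fifteen : s.rreg 15 = 0
  rarr_zero : ∀ j, s.rarr 0 j 0 = r j
  rarr_one : ∀ j, s.rarr 1 j 0 = u j

open Program

theorem Ready.of_eq {n m T : ℕ} {r u : ℕ → ℝ} {s s' : Memory} (h : Ready n m T r u s)
    (hn : ∀ x ∈ [0, 1, 2, 9, 10], s'.nreg x = s.nreg x)
    (hr : ∀ x ∈ [1, 2, 15], s'.rreg x = s.rreg x)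
    (ha : ∀ a ∈ [0, 1], s'.rarr a = s.rarr a) : Ready n m T r u s' where
  nreg_zero := by rw [hn 0 (by simp), h.nreg_zero]
  nreg_one := by rw [hn 1 (by simp), h.nreg_one]
  nreg_two := by rw [hn 2 (by simp), h.nreg_two]
  nreg_nine := by rw [hn 9 (by simp), h.nreg_nine]
  nreg_ten := by rw [hn 10 (by simp), h.nreg_ten]
  rreg_one := by rw [hr 1 (by simp), h.rreg_one]
  rreg_two := by rw [hr 2 (by simp), h.rreg_two]
  rreg_fifteen := by rw [hr 15 (by simp), h.rreg_fifteen]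
  rarr_zero j := by rw [ha 0 (by simp), h.rarr_zero]
  rarr_one j := by rw [ha 1 (by simp), h.rarr_one]

theorem Ready.of_frame {n m T : ℕ} {r u : ℕ → ℝ} {s s' : Memory} {P : Program}
    (h : Ready n m T r u s) (hF : Frame P s s') (hn : ∀ x ∈ [0, 1, 2, 9, 10], x ∉ P.wN)
    (hr : ∀ x ∈ [1, 2, 15], x ∉ P.wR) (ha : ∀ a ∈ [0, 1], a ∉ P.wRA) : Ready n m T r u s' :=
  h.of_eq (fun x hx => hF.nreg x (hn x hx)) (fun x hx => hF.rreg x (hr x hx))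
    fun x hx => hF.rarr x (ha x hx)

theorem Ready.setN {n m T : ℕ} {r u : ℕ → ℝ} {s : Memory} (h : Ready n m T r u s) {x k : ℕ}
    (hx : x ∉ [0, 1, 2, 9, 10]) : Ready n m T r u (s.tick.setN x k) :=
  h.of_eq (fun y hy => by
    have : y ≠ x := fun h => hx (h ▸ hy)
    simp [this]) (fun _ _ => rfl) fun _ _ => rfl

/-! ### Specifications of the subroutines -/

variable {T : ℕ} {r u : ℕ → ℝ}

theorem ensures_fillIncrements {s : Memory} (h0 : s.nreg 0 = n) (h9 : s.nreg 9 = 0)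
    (h1 : s.rreg 1 = 1) :
    Ensures fillIncrements s fun s' =>
      ∀ k < n, s'.rarr 3 0 k = s.rreg 6 * uniformGain (s.rreg 7) k := by
  have h := ensures_loop_frame (x := 14) (y := 0) (s := s)
    (P := .seq (.rcast 8 14) (.seq (.rop .add 9 8 7) (.seq (.rop .div 10 8 9)
      (.seq (.rop .add 8 8 1) (.seq (.rop .add 9 8 7) (.seq (.rop .div 11 8 9)
        (.seq (.rop .sub 10 11 10) (.seq (.rop .mul 10 6 10) (.rstore 3 9 14 10)))))))))
    (fun l s' => ∀ k < l, s'.rarr 3 0 k = s.rreg 6 * uniformGain (s.rreg 7) k)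
    (fun k hk => absurd hk (Nat.not_lt_zero k)) fun l hl s' hF hI => by
      have e9 := hF.nreg 9 (by decide)
      have e1 := hF.rreg 1 (by decide)
      have e6 := hF.rreg 6 (by decide)
      have e7 := hF.rreg 7 (by decide)
      simp [ArithOp.eval, e9, e1, e6, e7, h9, h1]
      intro k hk
      split_ifs with hkl
      · simp [hkl, uniformGain, uniformDemand]
      · exact hI k (by omega)
  rw [h0] at h
  exact h

/-- The loop runs over all `n` columns, but only the triangle of entries with row plus column below
`n` is meaningful. Each such entry is computed from two entries of the triangle, so the others do no
harm. -/
theorem ensures_casteljauRow {s : Memory} {l : ℕ} {v : ℕ → ℝ} (h0 : s.nreg 0 = n)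
    (h10 : s.nreg 10 = 1) (h15 : s.nreg 15 = l) (h16 : s.nreg 16 = l + 1)
    (h5 : s.rreg 5 = 1 - s.rreg 4)
    (hrow : ∀ k, k + l < n → s.rarr 3 l k = bernstein v (s.rreg 4) l k) :
    Ensures casteljauRow s fun s' =>
      ∀ k, k + (l + 1) < n → s'.rarr 3 (l + 1) k = bernstein v (s.rreg 4) (l + 1) k := by
  have h := ensures_loop_frame (x := 17) (y := 0) (s := s)
    (P := .seq (.nadd 18 17 10) (.seq (.rload 13 3 15 17) (.seq (.rload 14 3 15 18)
      (.seq (.rop .mul 13 5 13) (.seq (.rop .mul 14 4 14) (.seq (.rop .add 13 13 14)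
        (.rstore 3 16 17 13)))))))
    (fun c s' => (∀ k, k + l < n → s'.rarr 3 l k = bernstein v (s.rreg 4) l k) ∧
      ∀ k < c, k + (l + 1) < n → s'.rarr 3 (l + 1) k = bernstein v (s.rreg 4) (l + 1) k)
    ⟨hrow, fun k hk => absurd hk (Nat.not_lt_zero k)⟩ fun c hc s' hF hI => by
      have e10 := hF.nreg 10 (by decide)
      have e15 := hF.nreg 15 (by decide)
      have e16 := hF.nreg 16 (by decide)
      have e4 := hF.rreg 4 (by decide)
      have e5 := hF.rreg 5 (by decide)
      simp [ArithOp.eval, e10, e15, e16, e4, e5, h10, h15, h16, h5]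
      refine ⟨hI.1, fun k hk hkl => ?_⟩
      split_ifs with hkc
      · subst hkc
        rw [hI.1 k (by omega), hI.1 (k + 1) (by omega), bernstein]
      · exact hI.2 k (by omega) hkl
  rw [h0] at h
  exact h.mono fun s' hs' k hk => hs'.2 k (by omega) hk

theorem ensures_casteljau {s : Memory} {ρ μ : ℝ} (h0 : s.nreg 0 = n) (h9 : s.nreg 9 = 0)
    (h10 : s.nreg 10 = 1) (h5 : s.rreg 5 = 1 - s.rreg 4) (h12 : s.rreg 12 = 0)
    (hrow : ∀ k < n, s.rarr 3 0 k = ρ * uniformGain μ k) :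
    Ensures casteljau s fun s' => s'.rreg 12 = symmetricGain ρ μ (s.rreg 4) n := by
  have h := ensures_loop_frame (x := 15) (y := 0) (s := s)
    (P := .seq (.rload 12 3 15 9) (.seq (.nadd 16 15 10) casteljauRow))
    -- Register 12 is loaded from column 0 before the next row is computed. After `l ≥ 1` iterations
    -- it therefore holds the entry of row `l - 1`, which is `symmetricGain` at `l`; the initial 0
    -- matches `symmetricGain` at 0.
    (fun l s' => (∀ k, k + l < n →
        s'.rarr 3 l k = bernstein (fun k => ρ * uniformGain μ k) (s.rreg 4) l k) ∧
      s'.rreg 12 = symmetricGain ρ μ (s.rreg 4) l)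
    ⟨fun k hk => hrow k hk, h12⟩ fun l hl s' hF hI => by
      have e0 := hF.nreg 0 (by decide)
      have e9 := hF.nreg 9 (by decide)
      have e10 := hF.nreg 10 (by decide)
      have e4 := hF.rreg 4 (by decide)
      have e5 := hF.rreg 5 (by decide)
      rw [h0] at hl
      rw [ensures_seq, ensures_rload, ensures_seq, ensures_nadd]
      refine ((ensures_casteljauRow (n := n) (l := l) (v := fun k => ρ * uniformGain μ k)
        ?_ ?_ ?_ ?_ ?_ ?_).and (ensures_frame _ _)).mono fun s'' hs'' => ⟨?_, ?_⟩
      · simp [e0, h0]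
      · simp [e10, h10]
      · simp
      · simp [e10, h10]
      · simp [e4, e5, h5]
      · simpa [e4] using hI.1
      · simpa [e4] using hs''.1
      · rw [hs''.2.rreg 12 (by decide)]
        simp [e9, h9, symmetricGain, hI.1 0 (by omega)]
  rw [h0] at h
  exact h.mono fun s' hs' => hs'.2

theorem ensures_computeGain {s : Memory} (hR : Ready n m T r u s) :
    Ensures computeGain s fun s' =>
      s'.rreg 12 = symmetricGain (r (s.nreg 13)) (u (s.nreg 13)) (s.rarr 2 (s.nreg 13) 0) n := by
  unfold computeGain
  simp only [ensures_seq, ensures_rload, ensures_rop]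
  refine ((ensures_fillIncrements (n := n) ?_ ?_ ?_).and (ensures_frame _ _)).mono
    fun s' hs' => ?_
  · simp [hR.nreg_zero]
  · simp [hR.nreg_nine]
  · simp [hR.rreg_one]
  obtain ⟨hI, hF⟩ := hs'
  rw [ensures_rconst]
  have e0 := hF.nreg 0 (by decide)
  have e9 := hF.nreg 9 (by decide)
  have e10 := hF.nreg 10 (by decide)
  have e4 := hF.rreg 4 (by decide)
  have e5 := hF.rreg 5 (by decide)
  simp [hR.nreg_zero, hR.nreg_nine, hR.nreg_ten, hR.rreg_one, ArithOp.eval,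
    hR.rarr_zero, hR.rarr_one] at e0 e9 e10 e4 e5 hI
  refine (ensures_casteljau (n := n) (ρ := r (s.nreg 13)) (μ := u (s.nreg 13))
    ?_ ?_ ?_ ?_ ?_ ?_).mono fun s'' hs'' => ?_
  · simp [e0]
  · simp [e9]
  · simp [e10]
  · simp [e4, e5]
  · simp
  · simpa using hI
  · simpa [e4] using hs''

theorem ensures_findBest {s : Memory} (hR : Ready n m T r u s) (h12 : s.nreg 12 = 0)
    (h3 : s.rreg 3 = 0) :
    Ensures findBest s fun s' =>
      s'.nreg 12 = symmetricChoice n m r u fun j => s.rarr 2 j 0 := by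
  have h := ensures_loop_frame (x := 13) (y := 1) (s := s) (P := .seq computeGain
    (.ifR 3 12 (.seq (.nadd 12 13 9) (.rop .add 3 12 15)) (.nconst 19 0)))
    (fun k s' =>
      (s'.nreg 12, s'.rreg 3) = scan (fun j => symmetricGain (r j) (u j) (s.rarr 2 j 0) n) k)
    (by simp [h12, h3, scan]) fun k hk s' hF hI => by
      have hR' : Ready n m T r u (s'.tick.setN 13 k) :=
        (hR.of_frame hF (by decide) (by decide) (by decide)).setN (by decide)
      have e2 := hF.rarr 2 (by decide)
      refine ensures_seq_of (ensures_computeGain hR') fun s'' h12' hF' => ?_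
      have f12 := hF'.nreg 12 (by decide)
      have f13 := hF'.nreg 13 (by decide)
      have f3 := hF'.rreg 3 (by decide)
      have hR'' := hR'.of_frame hF' (by decide) (by decide) (by decide)
      have hp := Prod.ext_iff.1 hI
      simp only [Memory.nreg_setN, Memory.nreg_tick, Memory.rreg_setN, Memory.rreg_tick,
        Memory.rarr_setN, Memory.rarr_tick, if_true, e2] at h12' f12 f13 f3
      rw [if_neg (by decide)] at f12
      dsimp only at hp
      rw [ensures_ifR, scan, h12', f3, hp.2]
      split_ifs with hlt
      · simp [f13, hR''.nreg_nine, hR''.rreg_fifteen, ArithOp.eval, h12']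
      · simp [f12, f3, hI]
  rw [hR.nreg_one] at h
  exact h.mono fun s' hs' => (Prod.ext_iff.1 hs').1

theorem ensures_greedyStep {s : Memory} (hR : Ready n m T r u s) {x : ℕ → ℝ}
    (hx : ∀ j, s.rarr 2 j 0 = x j) :
    Ensures greedyStep s fun s' =>
      (∀ j, s'.rarr 2 j 0 = Function.update x (symmetricChoice n m r u x)
        (x (symmetricChoice n m r u x) + 1 / T) j) ∧
      s'.narr 1 (s.nreg 11) 0 = symmetricChoice n m r u x ∧
      (∀ t, t ≠ s.nreg 11 → s'.narr 1 t 0 = s.narr 1 t 0) := by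
  unfold greedyStep
  simp only [ensures_seq, ensures_nconst, ensures_rconst]
  refine ((ensures_findBest (n := n) (m := m) (T := T) (r := r) (u := u) ?_ ?_ ?_).and
    (ensures_frame _ _)).mono fun s' hs' => ?_
  · refine hR.of_eq (fun y hy => ?_) (fun y hy => ?_) fun _ _ => rfl
    · have : y ≠ 12 := by rintro rfl; revert hy; decide
      simp [this]
    · have : y ≠ 3 := by rintro rfl; revert hy; decide
      simp [this]
  · simp
  · simp
  obtain ⟨hI, hF⟩ := hs'
  have e9 := hF.nreg 9 (by decide)
  have e11 := hF.nreg 11 (by decide)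
  have er2 := hF.rreg 2 (by decide)
  have e2 := hF.rarr 2 (by decide)
  have e1 := hF.narr 1 (by decide)
  simp [hR.nreg_nine, hR.rreg_two, hx] at e9 e11 er2 e1 e2 hI
  simp [e9, e11, er2, e1, e2, hI, ArithOp.eval, hx]
  constructor
  · intro j
    rw [Function.update_apply]
  · intro t ht ht'
    exact absurd ht' ht

theorem ensures_greedy {s : Memory} (hR : Ready n m T r u s) (h2 : ∀ j, s.rarr 2 j 0 = 0) :
    Ensures greedy s fun s' => ∀ t < T,
      s'.narr 1 t 0 = symmetricChoice n m r u (symmetricPoint n m T r u t) := by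
  have h := ensures_loop_frame (x := 11) (y := 2) (s := s) (P := greedyStep)
    (fun l s' => (∀ j, s'.rarr 2 j 0 = symmetricPoint n m T r u l j) ∧ ∀ t < l,
      s'.narr 1 t 0 = symmetricChoice n m r u (symmetricPoint n m T r u t))
    ⟨by simpa [symmetricPoint] using h2, fun k hk => absurd hk (Nat.not_lt_zero k)⟩
    fun l hl s' hF hI => by
      refine (ensures_greedyStep (n := n) (m := m) (T := T) (r := r) (u := u)
        ((hR.of_frame hF (by decide) (by decide) (by decide)).setN (by decide)) hI.1).mono
          fun s'' hs'' => ⟨hs''.1, fun t ht => ?_⟩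
      have h11 : (s'.tick.setN 11 l).nreg 11 = l := by simp
      rw [h11] at hs''
      rcases Nat.lt_succ_iff_lt_or_eq.1 ht with ht | rfl
      · rw [hs''.2.2 t ht.ne]
        exact hI.2 t ht
      · exact hs''.2.1
  rw [hR.nreg_two] at h
  exact h.mono fun s' hs' => hs'.2

theorem ensures_multiply {s : Memory} (h9 : s.nreg 9 = 0) :
    Ensures multiply s fun s' => s'.nreg 2 = s.nreg 3 * s.nreg 2 := by
  unfold multiply
  rw [ensures_seq, ensures_nconst]
  refine ensures_seq_of (ensures_loop_frame (fun k s' => s'.nreg 5 = k * s.nreg 2) (by simp)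
    fun k hk s' hF hI => ?_) fun s' hI hF => ?_
  · have e2 := hF.nreg 2 (by decide)
    simp at e2
    simp [hI, e2, Nat.succ_mul]
  · have e9 := hF.nreg 9 (by decide)
    simp [h9] at e9
    simp at hI
    simp [e9, hI]

theorem ensures_prepare {s : Memory} {b : ℕ} : Ensures (prepare b) s fun s' =>
    s'.nreg 3 = s.nreg 0 + s.nreg 1 + 1 ∧ s'.nreg 4 = b ∧ s'.nreg 2 = b ∧ s'.nreg 10 = 1 := by
  simp [prepare]

theorem ensures_stepSize {s : Memory} (h9 : s.nreg 9 = 0) :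
    Ensures stepSize s fun s' => s'.nreg 2 = s.nreg 3 ^ s.nreg 4 * s.nreg 2 ∧
      s'.rreg 1 = 1 ∧ s'.rreg 2 = 1 / (s'.nreg 2 : ℝ) := by
  unfold stepSize
  refine ensures_seq_of (ensures_loop_frame
    (fun k s' => s'.nreg 2 = s.nreg 3 ^ k * s.nreg 2) (by simp) fun k hk s' hF hI => ?_)
    fun s' hI hF => ?_
  · have e9 := hF.nreg 9 (by decide)
    have e3 := hF.nreg 3 (by decide)
    refine (ensures_multiply ?_).mono fun s'' hs'' => ?_
    · simp [e9, h9]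
    · simp at hs''
      rw [hs'', e3, hI, pow_succ]
      ring
  · simp [ArithOp.eval, hI]

/-! ### Correctness of the symmetric algorithm -/

/-- Conditioning on one element is one step of de Casteljau's recursion; the shift `k` counts the
elements already drawn. -/
theorem subsetSum_const_eq_bernstein {ε : Type} [DecidableEq ε] (C : Finset ε) (ψ : ℕ → ℝ) (x : ℝ)
    (k : ℕ) :
    subsetSum C (fun B => ψ (k + B.card)) (fun _ => x) = bernstein ψ x C.card k := by
  induction C using Finset.induction_on generalizing k with
  | empty => simp [subsetSum, bernstein]
  | insert e C he ih =>
    have h : subsetSum C (fun B => ψ (k + (insert e B).card)) (fun _ => x) =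
        subsetSum C (fun B => ψ (k + 1 + B.card)) fun _ => x :=
      subsetSum_congr (fun B hB => by
        rw [Finset.card_insert_of_notMem fun h => he (hB h)]
        congr 1
        ring) fun _ _ => rfl
    rw [subsetSum_insert he, h, ih, ih, Finset.card_insert_of_notMem he, bernstein]
    ring

/-- When all rows agree, the number of other consumers at supplier `j` is binomial with parameters n
- 1 and `x j`. The partial derivative is thus computable exactly, without sampling, and is the same
for every consumer. -/
theorem MNLUniform.multilinearExtension_slope_symmetric (I : MNLUniform n m) (x : ℕ → ℝ)
    (i : Fin n) (j : Fin m) :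
    multilinearExtension (slope I.welfare (i, j)) (fun e => x e.2) =
      symmetricGain (I.r j) (I.u j) (x j) n := by
  have h : slope I.welfare (i, j) = fun A =>
      (fun k => I.r j * uniformGain (I.u j) k) (part A j ∩ Finset.univ.erase i).card := by
    funext A
    rw [I.slope_welfare, Finset.inter_erase, Finset.inter_univ]
  have hb := subsetSum_const_eq_bernstein (Finset.univ.erase i)
    (fun k => I.r j * uniformGain (I.u j) k) (x j) 0
  simp only [zero_add] at hb
  rw [h]
  refine (multilinearExtension_card_part _ j _ fun k => I.r j * uniformGain (I.u j) k).trans ?_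
  rw [hb, Finset.card_erase_of_mem (Finset.mem_univ i),
    Finset.card_univ, Fintype.card_fin]
  cases n with
  | zero => exact i.elim0
  | succ n => rfl

theorem bernstein_nonneg {v : ℕ → ℝ} (hv : ∀ k, 0 ≤ v k) {x : ℝ} (h0 : 0 ≤ x) (h1 : x ≤ 1)
    (l k : ℕ) : 0 ≤ bernstein v x l k := by
  induction l generalizing k with
  | zero => exact hv k
  | succ l ih =>
    exact add_nonneg (mul_nonneg (sub_nonneg.2 h1) (ih k)) (mul_nonneg h0 (ih (k + 1)))

theorem symmetricGain_nonneg {r u x : ℝ} (hr : 0 ≤ r) (hu : 0 ≤ u) (h0 : 0 ≤ x) (h1 : x ≤ 1)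
    (n : ℕ) : 0 ≤ symmetricGain r u x n := by
  cases n with
  | zero => exact le_rfl
  | succ l => exact bernstein_nonneg (fun k => mul_nonneg hr (uniformGain_nonneg hu k)) h0 h1 _ _

theorem le_scan_snd (g : ℕ → ℝ) {j k : ℕ} (h : j < k) : g j ≤ (scan g k).2 := by
  induction k with
  | zero => omega
  | succ k ih =>
    rw [scan]
    rcases Nat.lt_succ_iff_lt_or_eq.1 h with h | rfl
    · split_ifs with hlt
      · exact (ih h).trans hlt.le
      · exact ih h
    · split_ifs with hlt
      · exact le_rfl
      · exact not_lt.1 hlt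

/-- Nonnegativity makes the initial pair (0, 0) harmless: if no value exceeds 0, then `g 0 = 0` and
position 0 is correct. -/
theorem scan_spec {g : ℕ → ℝ} (hg : ∀ j, 0 ≤ g j) {k : ℕ} (hk : 0 < k) :
    (scan g k).1 < k ∧ g (scan g k).1 = (scan g k).2 := by
  induction k with
  | zero => omega
  | succ k ih =>
    rw [scan]
    split_ifs with hlt
    · exact ⟨Nat.lt_succ_self k, rfl⟩
    · rcases k.eq_zero_or_pos with rfl | hk
      · exact ⟨Nat.zero_lt_one, le_antisymm (not_lt.1 hlt) (hg 0)⟩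
      · exact ⟨(ih hk).1.trans (Nat.lt_succ_self k), (ih hk).2⟩

theorem symmetricPoint_mem {T : ℕ} {r u : ℕ → ℝ} (t j : ℕ) :
    0 ≤ symmetricPoint n m T r u t j ∧ symmetricPoint n m T r u t j ≤ t / T := by
  induction t generalizing j with
  | zero => simp [symmetricPoint]
  | succ t ih =>
    have h0 : (0 : ℝ) ≤ 1 / T := by positivity
    have h : ((t + 1 : ℕ) : ℝ) / T = t / T + 1 / T := by
      push_cast
      ring
    rw [symmetricPoint, Function.update_apply, h]
    split_ifs with hj
    · exact ⟨add_nonneg (ih _).1 h0, by linarith [(ih (symmetricChoice n m r u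
        (symmetricPoint n m T r u t))).2]⟩
    · exact ⟨(ih j).1, (ih j).2.trans (by linarith)⟩

/-- Each coordinate is the frequency of a supplier among the choices made, which is what lets a
uniformly random step do the rounding. -/
theorem symmetricPoint_eq_sum (T : ℕ) (r u : ℕ → ℝ) (t j : ℕ) :
    symmetricPoint n m T r u t j = ∑ t' ∈ Finset.range t,
      if symmetricChoice n m r u (symmetricPoint n m T r u t') = j then 1 / (T : ℝ) else 0 := by
  induction t with
  | zero => simp [symmetricPoint]
  | succ t ih =>
    rw [Finset.sum_range_succ, ← ih, symmetricPoint, Function.update_apply]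
    by_cases h : j = symmetricChoice n m r u (symmetricPoint n m T r u t)
    · rw [if_pos h, if_pos h.symm, ← h]
    · rw [if_neg h, if_neg (Ne.symm h), add_zero]

/-- The revenues as an array. -/
def MNLUniform.revenueArray (I : MNLUniform n m) (j : ℕ) : ℝ := if h : j < m then I.r ⟨j, h⟩ else 0

/-- The outside scores as an array. -/
def MNLUniform.scoreArray (I : MNLUniform n m) (j : ℕ) : ℝ := if h : j < m then I.u ⟨j, h⟩ else 0

theorem MNLUniform.revenueArray_nonneg (I : MNLUniform n m) (j : ℕ) : 0 ≤ I.revenueArray j := by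
  unfold MNLUniform.revenueArray
  split_ifs
  · exact I.r_nonneg _
  · exact le_rfl

theorem MNLUniform.scoreArray_nonneg (I : MNLUniform n m) (j : ℕ) : 0 ≤ I.scoreArray j := by
  unfold MNLUniform.scoreArray
  split_ifs
  · exact I.u_nonneg _
  · exact le_rfl

/-- The iterates of the symmetric algorithm for an instance. -/
def MNLUniform.point (I : MNLUniform n m) (T t j : ℕ) : ℝ :=
  symmetricPoint n m T I.revenueArray I.scoreArray t j

/-- The choices of the symmetric algorithm for an instance. -/
def MNLUniform.choice (I : MNLUniform n m) (T t : ℕ) : ℕ :=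
  symmetricChoice n m I.revenueArray I.scoreArray (I.point T t)

theorem MNLUniform.point_le_one (I : MNLUniform n m) {T t : ℕ} (ht : t ≤ T) (j : ℕ) :
    I.point T t j ≤ 1 :=
  (symmetricPoint_mem t j).2.trans
    (div_le_one_of_le₀ (by exact_mod_cast ht) (Nat.cast_nonneg T))

theorem MNLUniform.symmetricGain_point_nonneg (I : MNLUniform n m) {T t : ℕ} (ht : t ≤ T)
    (j : ℕ) : 0 ≤ symmetricGain (I.revenueArray j) (I.scoreArray j) (I.point T t j) n :=
  symmetricGain_nonneg (I.revenueArray_nonneg j) (I.scoreArray_nonneg j)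
    (symmetricPoint_mem t j).1 (I.point_le_one ht j) n

theorem MNLUniform.choice_lt (I : MNLUniform n m) (hm : 0 < m) {T t : ℕ} (ht : t ≤ T) :
    I.choice T t < m := (scan_spec (I.symmetricGain_point_nonneg ht) hm).1

/-- The gradient at a point with equal rows does not depend on the consumer, so one supplier
maximizes every row at once. Moving all rows towards it is a legitimate tie-breaking and keeps the
rows equal. -/
theorem MNLUniform.isContinuousGreedyRun_point (I : MNLUniform n m) (hm : 0 < m) (T : ℕ) :
    IsContinuousGreedyRun I.welfare T fun t e => I.point T t e.2 where
  start := rfl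
  step t ht := by
    have hg := I.symmetricGain_point_nonneg (T := T) ht.le
    set g : ℕ → ℝ := fun j => symmetricGain (I.revenueArray j) (I.scoreArray j) (I.point T t j) n
      with hgdef
    have hspec := scan_spec hg hm
    set c : Fin m := ⟨I.choice T t, I.choice_lt hm ht.le⟩ with hc
    have hgrad : ∀ w : Fin n × Fin m → ℝ, fderiv ℝ (multilinearExtension I.welfare)
        (fun e => I.point T t e.2) w = ∑ e, w e * g e.2 := by
      intro w
      rw [fderiv_multilinearExtension]
      refine Finset.sum_congr rfl fun e _ => ?_
      rw [I.multilinearExtension_slope_symmetric]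
      simp [hgdef, MNLUniform.revenueArray, MNLUniform.scoreArray]
    have hbest : ∀ j : Fin m, g j ≤ g c := fun j => by
      have h1 := le_scan_snd g j.2
      rw [← hspec.2] at h1
      exact h1
    refine ⟨assignmentVector fun _ => c, assignmentVector_mem _, fun w hw => ?_, fun i => ?_, ?_⟩
    · obtain ⟨hw0, hw1⟩ := partitionPolytope_subset hw
      simp only [Set.mem_ofPred_eq, hgrad]
      rw [sum_assignmentVector_mul _ fun e : Fin n × Fin m => g e.2, Fintype.sum_prod_type]
      refine Finset.sum_le_sum fun i _ => ?_
      calc ∑ j : Fin m, w (i, j) * g j ≤ ∑ j, w (i, j) * g c :=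
            Finset.sum_le_sum fun j _ => mul_le_mul_of_nonneg_left (hbest j) (hw0 _)
        _ = (∑ j, w (i, j)) * g c := (Finset.sum_mul _ _ _).symm
        _ ≤ g c := mul_le_of_le_one_left (hg _) (hw1 i)
    · simp [assignmentVector]
    · funext e
      simp only [Pi.add_apply, Pi.smul_apply, smul_eq_mul, assignmentVector]
      have h : I.point T (t + 1) e.2 = if (e.2 : ℕ) = I.choice T t then
          I.point T t (I.choice T t) + 1 / T else I.point T t e.2 := by
        conv_lhs => rw [MNLUniform.point, symmetricPoint, Function.update_apply]
        rfl
      rw [h]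
      by_cases hj : (e.2 : ℕ) = I.choice T t
      · have : e.2 = c := Fin.ext hj
        rw [if_pos hj, if_pos this, hj, mul_one]
      · have : e.2 ≠ c := fun h => hj (congrArg Fin.val h)
        rw [if_neg hj, if_neg this, mul_zero, add_zero]

/-! ### The law of the rounding step -/

theorem uniformOfFintype_bind_map {X Y : Type} [Fintype X] [Nonempty X] {k : ℕ}
    (F : (Fin k → X) → X → Y) :
    ((PMF.uniformOfFintype (Fin k → X)).bind fun ω => (PMF.uniformOfFintype X).map (F ω)) =
      (PMF.uniformOfFintype (Fin (k + 1) → X)).map fun ω => F (Fin.init ω) (ω (Fin.last k)) := by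
  classical
  ext y
  simp only [PMF.bind_apply, PMF.map_apply, PMF.uniformOfFintype_apply, tsum_fintype,
    Fintype.card_pi, Finset.prod_const, Finset.card_univ, Fintype.card_fin, Finset.mul_sum]
  rw [← (Fin.snocEquiv fun _ : Fin (k + 1) => X).sum_comp, Fintype.sum_prod_type, Finset.sum_comm]
  refine Finset.sum_congr rfl fun x _ => Finset.sum_congr rfl fun ω _ => ?_
  have h : Fin.init ((Fin.snocEquiv fun _ : Fin (k + 1) => X) (x, ω)) = ω :=
    Fin.init_snoc (α := fun _ => X) x ω
  simp only [h, Fin.snocEquiv_apply, Fin.snoc_last, mul_ite, mul_zero]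
  refine if_congr Iff.rfl ?_ rfl
  rw [pow_succ, Nat.cast_mul, ENNReal.mul_inv (by simp) (by simp)]

theorem exec_rand_of_eq {x y k : ℕ} {s : Memory} (h : s.nreg y = k + 1) :
    (Program.rand x y).exec s =
      (PMF.uniformOfFintype (Fin (k + 1))).map fun d : Fin (k + 1) => s.tick.setN x d := by
  unfold Program.exec
  split
  · omega
  · rename_i k' hk'
    obtain rfl : k' = k := by omega
    refine (PMF.map_bind _ _ _).trans ?_
    rw [← PMF.bind_pure_comp]
    congr 1
    funext d
    exact PMF.pure_map _ _

/-- The memory after the assignment of one consumer, when `d` was drawn. -/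
def assignMemory (s : Memory) (d : ℕ) : Memory :=
  (((s.tick.setN 21 d).tick.setN 22 (s.narr 1 d (s.nreg 9))).tick.storeN 0 (s.nreg 20)
    (s.narr 1 d (s.nreg 9)) (s.nreg 10))

theorem exec_assign {k : ℕ} {s : Memory} (h : s.nreg 2 = k + 1) :
    Program.assign.exec s =
      (PMF.uniformOfFintype (Fin (k + 1))).map fun d : Fin (k + 1) => assignMemory s d := by
  have h1 : Program.assign.exec s = ((Program.rand 21 2).exec s).bind
      (Program.seq (.nload 22 1 21 9) (.nstore 0 20 22 10)).exec := rfl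
  rw [h1, exec_rand_of_eq h, PMF.bind_map, ← PMF.bind_pure_comp]
  congr 1
  funext d
  simp [Program.exec, assignMemory]

/-- Writing the memory as a function of a uniform tuple of draws turns the law of the output into a
count of tuples. -/
theorem iterLaw_assign {k T : ℕ} {s : Memory} {c : ℕ → ℕ} (h2 : s.nreg 2 = T + 1)
    (h9 : s.nreg 9 = 0) (h10 : s.nreg 10 = 1) (h1 : ∀ t < T + 1, s.narr 1 t 0 = c t)
    (h0 : ∀ i j, s.narr 0 i j = 0) :
    ∃ st : (Fin k → Fin (T + 1)) → Memory,
      iterLaw 20 Program.assign s k = (PMF.uniformOfFintype _).map st ∧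
      ∀ ω, (st ω).nreg 2 = T + 1 ∧ (st ω).nreg 9 = 0 ∧ (st ω).nreg 10 = 1 ∧
        (∀ t < T + 1, (st ω).narr 1 t 0 = c t) ∧
        ∀ i j, ((st ω).narr 0 i j ≠ 0 ↔ ∃ h : i < k, c (ω ⟨i, h⟩) = j) := by
  induction k with
  | zero =>
    refine ⟨fun _ => s.tick, ?_, fun ω => ⟨h2, h9, h10, h1, ?_⟩⟩
    · rw [iterLaw_zero]
      exact (PMF.map_const _ _).symm
    · simp [h0]
  | succ k ih =>
    obtain ⟨st, hst, hI⟩ := ih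
    refine ⟨fun ω => assignMemory ((st (Fin.init ω)).tick.setN 20 k) (ω (Fin.last k)), ?_,
      fun ω => ?_⟩
    · rw [iterLaw_succ, hst, PMF.bind_map, ← uniformOfFintype_bind_map
        (fun ω d => assignMemory ((st ω).tick.setN 20 k) d)]
      congr 1
      funext ω
      refine exec_assign ?_
      simpa using (hI ω).1
    · obtain ⟨i2, i9, i10, i1, i0⟩ := hI (Fin.init ω)
      refine ⟨by simp [assignMemory, i2], by simp [assignMemory, i9], by simp [assignMemory, i10],
        fun t ht => by simp [assignMemory, i1 t ht], fun i j => ?_⟩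
      have hlast := i1 (ω (Fin.last k)) (ω (Fin.last k)).2
      simp only [assignMemory, Memory.narr_storeN, Memory.narr_setN, Memory.narr_tick,
        Memory.nreg_setN, Memory.nreg_tick]
      norm_num
      rw [i9, hlast, i10]
      rcases lt_trichotomy i k with hik | rfl | hik
      · rw [if_neg (by omega), ← ne_eq, i0]
        constructor
        · rintro ⟨h, rfl⟩
          exact ⟨by omega, rfl⟩
        · rintro ⟨h, rfl⟩
          exact ⟨hik, rfl⟩
      · have hz : (st (Fin.init ω)).narr 0 i j = 0 := by
          by_contra hne
          obtain ⟨h, -⟩ := (i0 i j).1 hne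
          omega
        rw [hz]
        constructor
        · intro h
          refine ⟨by omega, ?_⟩
          by_contra hne
          exact h (if_neg fun h' => hne h'.2.symm)
        · rintro ⟨h, h'⟩
          rw [if_pos ⟨rfl, h'.symm⟩]
          norm_num
      · have hz : (st (Fin.init ω)).narr 0 i j = 0 := by
          by_contra hne
          obtain ⟨h, -⟩ := (i0 i j).1 hne
          omega
        rw [if_neg (by omega), hz]
        constructor
        · exact fun h => absurd rfl h
        · rintro ⟨h, -⟩
          omega

/-- Expanding the product over consumers of sums over steps selects one step for each consumer, and
every selection has weight T⁻ⁿ. -/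
theorem algorithmLaw_eq_sum {T : ℕ} (c : Fin T → Fin m) (S : MenuProfile n m) :
    algorithmLaw (fun e : Fin n × Fin m => ∑ t, if c t = e.2 then 1 / (T : ℝ) else 0) S =
      ∑ ω : Fin n → Fin T, if menusOf (partitionOf fun i => c (ω i)) = S then
        (1 / (T : ℝ)) ^ n else 0 := by
  classical
  have h : ∀ a : Fin n → Fin m, ∏ i, ∑ t, (if c t = a i then 1 / (T : ℝ) else 0) =
      ∑ ω : Fin n → Fin T, if (fun i => c (ω i)) = a then (1 / (T : ℝ)) ^ n else 0 := by
    intro a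
    rw [Finset.prod_univ_sum (fun _ => Finset.univ) fun i t => if c t = a i then 1 / (T : ℝ) else 0,
      Fintype.piFinset_univ]
    refine Finset.sum_congr rfl fun ω _ => ?_
    rw [Finset.prod_ite_zero]
    simp [funext_iff]
  unfold algorithmLaw
  simp only [h]
  have h2 : ∀ a : Fin n → Fin m, (if menusOf (partitionOf a) = S then
      ∑ ω : Fin n → Fin T, (if (fun i => c (ω i)) = a then (1 / (T : ℝ)) ^ n else 0) else 0) =
      ∑ ω : Fin n → Fin T, if (fun i => c (ω i)) = a then
        (if menusOf (partitionOf a) = S then (1 / (T : ℝ)) ^ n else 0) else 0 := by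
    intro a
    split_ifs with ha <;> simp
  simp only [h2]
  rw [Finset.sum_comm]
  refine Finset.sum_congr rfl fun ω _ => ?_
  rw [Finset.sum_ite_eq]
  simp

theorem map_output_exec_rounding {T : ℕ} {s : Memory} {c : Fin (T + 1) → Fin m}
    (hn : s.nreg 0 = n) (h2 : s.nreg 2 = T + 1) (h9 : s.nreg 9 = 0) (h10 : s.nreg 10 = 1)
    (h1 : ∀ t : Fin (T + 1), s.narr 1 t 0 = c t) (h0 : ∀ i j, s.narr 0 i j = 0)
    (S : MenuProfile n m) :
    ((Program.rounding.exec s).map (Memory.output n m)) S = ENNReal.ofReal (algorithmLaw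
      (fun e => ∑ t, if c t = e.2 then 1 / ((T + 1 : ℕ) : ℝ) else 0) S) := by
  classical
  obtain ⟨st, hst, hI⟩ := iterLaw_assign (k := n) (s := s)
    (c := fun t => if h : t < T + 1 then c ⟨t, h⟩ else 0) h2 h9 h10
    (fun t ht => by rw [dif_pos ht]; exact h1 ⟨t, ht⟩) h0
  have hout : ∀ ω, Memory.output n m (st ω) = menusOf (partitionOf fun i => c (ω i)) := by
    intro ω
    funext i
    rw [menusOf_partitionOf]
    ext j
    simp [Memory.output, (hI ω).2.2.2.2, Fin.ext_iff, eq_comm, (ω i).is_le]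
  rw [Program.rounding, exec_loop, hn, hst, PMF.map_comp, PMF.map_apply, tsum_fintype,
    algorithmLaw_eq_sum, ENNReal.ofReal_sum_of_nonneg fun ω _ => by positivity]
  refine Finset.sum_congr rfl fun ω _ => ?_
  rw [Function.comp_apply, hout, PMF.uniformOfFintype_apply]
  by_cases h : menusOf (partitionOf fun i => c (ω i)) = S
  · rw [if_pos h.symm, if_pos h, one_div, ENNReal.ofReal_pow (by positivity),
      ENNReal.ofReal_inv_of_pos (by positivity), ENNReal.ofReal_natCast]
    simp [ENNReal.inv_pow]
  · rw [if_neg (Ne.symm h), if_neg h, ENNReal.ofReal_zero]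

/-! ### The complete program -/

/-- The continuous greedy algorithm with `b (n + m + 1) ^ b` steps. -/
def Program.continuousGreedy (b : ℕ) : Program :=
  .seq (.prepare b) (.seq .stepSize .greedy)

/-- The memory after the continuous greedy algorithm. -/
structure MNLUniform.GreedyDone (I : MNLUniform n m) (T : ℕ) (s : Memory) : Prop where
  nreg_zero : s.nreg 0 = n
  nreg_two : s.nreg 2 = T
  nreg_nine : s.nreg 9 = 0
  nreg_ten : s.nreg 10 = 1
  narr_one : ∀ t < T, s.narr 1 t 0 = I.choice T t
  narr_zero : ∀ i j, s.narr 0 i j = 0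
  time_le : s.time ≤ 5 + Program.stepSize.cost T + Program.greedy.cost T

theorem ensures_continuousGreedy (I : MNLUniform n m) {b : ℕ} (hb : 0 < b) :
    Ensures (Program.continuousGreedy b) I.input (I.GreedyDone (b * (n + m + 1) ^ b)) := by
  set T := b * (n + m + 1) ^ b with hT
  -- This and `hbT` show that all loop bounds are at most `T`, so one `N = T` serves in the later
  -- cost estimates.
  have hXT : n + m + 1 ≤ T := by
    calc n + m + 1 = 1 * (n + m + 1) ^ 1 := by ring
      _ ≤ b * (n + m + 1) ^ b := Nat.mul_le_mul hb (Nat.pow_le_pow_right (by omega) hb)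
  have hbT : b ≤ T := Nat.le_mul_of_pos_right _ (by positivity)
  refine ensures_seq_of ((ensures_prepare (b := b)).and (ensures_time (R := []) (N := 0) _ _
    (by simp) (List.Subset.refl _) (by simp))) fun s₁ h₁ F₁ => ?_
  obtain ⟨⟨h3, h4, h2, h10⟩, ht₁⟩ := h₁
  have a9 := F₁.nreg 9 (by simp [Program.prepare, Program.wN])
  have a0 := F₁.nreg 0 (by simp [Program.prepare, Program.wN])
  have a1 := F₁.nreg 1 (by simp [Program.prepare, Program.wN])
  have ar := F₁.rreg 15 (by simp [Program.prepare, Program.wR])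
  have aa : ∀ a, s₁.rarr a = I.input.rarr a := fun a =>
    F₁.rarr a (by simp [Program.prepare, Program.wRA])
  have an : s₁.narr 0 = I.input.narr 0 := F₁.narr 0 (by simp [Program.prepare, Program.wNA])
  have h0 : I.input.nreg 0 = n := rfl
  have h1 : I.input.nreg 1 = m := rfl
  have h9 : I.input.nreg 9 = 0 := rfl
  rw [h0, h1] at h3
  rw [h0] at a0
  rw [h1] at a1
  rw [h9] at a9
  refine ensures_seq_of ((ensures_stepSize a9).and (ensures_time (R := [3, 4]) (N := T) _ _
    (by decide) (by decide) (by simp [h3, h4, hXT, hbT]))) fun s₂ h₂ F₂ => ?_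
  obtain ⟨⟨hT₂, hr1, hr2⟩, ht₂⟩ := h₂
  rw [h3, h4, h2, mul_comm, ← hT] at hT₂
  have hR : Ready n m T I.revenueArray I.scoreArray s₂ := by
    refine ⟨?_, ?_, hT₂, ?_, ?_, hr1, by rw [hr2, hT₂], ?_, fun j => ?_, fun j => ?_⟩
    · rw [F₂.nreg 0 (by decide), a0]
    · rw [F₂.nreg 1 (by decide), a1]
    · rw [F₂.nreg 9 (by decide), a9]
    · rw [F₂.nreg 10 (by decide), h10]
    · rw [F₂.rreg 15 (by decide), ar]
      rfl
    · rw [F₂.rarr 0 (by decide), aa]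
      simp [MNLUniform.input, MNLUniform.revenueArray]
    · rw [F₂.rarr 1 (by decide), aa]
      simp [MNLUniform.input, MNLUniform.scoreArray]
  have hy : ∀ j, s₂.rarr 2 j 0 = 0 := fun j => by
    rw [F₂.rarr 2 (by decide), aa]
    simp [MNLUniform.input]
  refine ((ensures_greedy hR hy).and ((ensures_time (R := [0, 1, 2]) (N := T) _ _
    (by decide) (by decide) ?_).and (ensures_frame _ _))).mono fun s₃ h₃ => ?_
  · simp only [List.mem_cons, List.not_mem_nil, or_false]
    rintro y (rfl | rfl | rfl)
    · rw [hR.nreg_zero]; omega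
    · rw [hR.nreg_one]; omega
    · rw [hR.nreg_two]
  obtain ⟨hc, ht₃, F₃⟩ := h₃
  refine ⟨?_, ?_, ?_, ?_, hc, fun i j => ?_, ?_⟩
  · rw [F₃.nreg 0 (by decide), hR.nreg_zero]
  · rw [F₃.nreg 2 (by decide), hR.nreg_two]
  · rw [F₃.nreg 9 (by decide), hR.nreg_nine]
  · rw [F₃.nreg 10 (by decide), hR.nreg_ten]
  · rw [F₃.narr 0 (by decide), F₂.narr 0 (by decide), an]
    rfl
  · have hti : I.input.time = 0 := rfl
    have hcost : (Program.prepare b).cost 0 = 5 := rfl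
    omega

/-- The exponent 4 comes from the deepest nesting: greedy steps, suppliers, rows of the scheme,
entries of a row. -/
theorem cost_le {T : ℕ} (hT : 0 < T) :
    5 + Program.stepSize.cost T + Program.greedy.cost T + Program.rounding.cost T ≤
      200 * T ^ 4 := by
  have h1 : 1 ≤ T ^ 4 := Nat.one_le_pow _ _ hT
  have h2 : T ≤ T ^ 4 := Nat.le_self_pow (by norm_num) T
  have h3 : T ^ 2 ≤ T ^ 4 := Nat.pow_le_pow_right hT (by norm_num)
  have h4 : T ^ 3 ≤ T ^ 4 := Nat.pow_le_pow_right hT (by norm_num)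
  simp only [Program.stepSize, Program.greedy, Program.rounding, Program.cost, Program.multiply,
    Program.greedyStep, Program.findBest, Program.computeGain, Program.fillIncrements,
    Program.casteljau, Program.casteljauRow, Program.assign]
  ring_nf
  omega

theorem program_time_le (I : MNLUniform n m) {b : ℕ} (hb : 0 < b) :
    Ensures (.seq (.continuousGreedy b) .rounding) I.input fun s =>
      s.time ≤ 200 * (b * (n + m + 1) ^ b) ^ 4 := by
  have hT : 0 < b * (n + m + 1) ^ b := by positivity
  refine ensures_seq_of (ensures_continuousGreedy I hb) fun s h _ => ?_
  refine (ensures_time (R := [0]) (N := b * (n + m + 1) ^ b) _ _ (by decide) (by decide)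
    ?_).mono fun s' h' => ?_
  · simp only [List.mem_singleton, forall_eq, h.nreg_zero]
    calc n ≤ n + m + 1 := by omega
      _ = 1 * (n + m + 1) ^ 1 := by ring
      _ ≤ b * (n + m + 1) ^ b := Nat.mul_le_mul hb (Nat.pow_le_pow_right (by omega) hb)
  · have := cost_le hT
    have := h.time_le
    omega

theorem exists_polynomial_bound (a b d k : ℕ) :
    ∃ c : ℕ, ∀ x, 0 < x → a * (b * x ^ k) ^ d ≤ c * x ^ c := by
  refine ⟨a * b ^ d + k * d, fun x hx => ?_⟩
  calc a * (b * x ^ k) ^ d = a * b ^ d * x ^ (k * d) := by rw [mul_pow, ← pow_mul, mul_assoc]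
    _ ≤ _ := Nat.mul_le_mul (Nat.le_add_right _ _) (Nat.pow_le_pow_right hx (Nat.le_add_left _ _))

theorem map_output_program (I : MNLUniform n m) (hm : 0 < m) {b : ℕ} (hb : 0 < b)
    (S : MenuProfile n m) :
    ((Program.exec (.seq (.continuousGreedy b) .rounding) I.input).map (Memory.output n m)) S =
      ENNReal.ofReal (algorithmLaw
        (fun e => I.point (b * (n + m + 1) ^ b) (b * (n + m + 1) ^ b) e.2) S) := by
  obtain ⟨T, hT⟩ : ∃ T, b * (n + m + 1) ^ b = T + 1 :=
    Nat.exists_eq_add_one.2 (by positivity)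
  have hrun := ensures_continuousGreedy I hb
  rw [hT] at hrun ⊢
  have hpoint : (fun e : Fin n × Fin m => I.point (T + 1) (T + 1) e.2) = fun e =>
      ∑ t : Fin (T + 1), if (⟨I.choice (T + 1) t, I.choice_lt hm t.2.le⟩ : Fin m) = e.2 then
        1 / ((T + 1 : ℕ) : ℝ) else 0 := by
    funext e
    rw [MNLUniform.point, symmetricPoint_eq_sum, Finset.sum_range]
    simp only [Fin.ext_iff]
    rfl
  have hexec : ((Program.exec (.seq (.continuousGreedy b) .rounding) I.input).map
      (Memory.output n m)) S = ∑' s, (Program.continuousGreedy b).exec I.input s *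
        ((Program.rounding.exec s).map (Memory.output n m)) S := by
    rw [show Program.exec (.seq (.continuousGreedy b) .rounding) I.input =
      ((Program.continuousGreedy b).exec I.input).bind Program.rounding.exec from rfl,
      PMF.map_bind, PMF.bind_apply]
  rw [hexec, hpoint]
  -- Every memory reachable after the greedy phase leads to the same output law, so this law factors
  -- out of the sum and the remaining probabilities add up to one.
  have hterm : ∀ s, (Program.continuousGreedy b).exec I.input s *
      ((Program.rounding.exec s).map (Memory.output n m)) S =
      (Program.continuousGreedy b).exec I.input s * ENNReal.ofReal (algorithmLaw
        (fun e : Fin n × Fin m => ∑ t : Fin (T + 1),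
          if (⟨I.choice (T + 1) t, I.choice_lt hm t.2.le⟩ : Fin m) = e.2 then
            1 / ((T + 1 : ℕ) : ℝ) else 0) S) := by
    intro s
    by_cases hs : s ∈ ((Program.continuousGreedy b).exec I.input).support
    · have h := hrun s hs
      rw [map_output_exec_rounding h.nreg_zero h.nreg_two h.nreg_nine h.nreg_ten
        (c := fun t => ⟨I.choice (T + 1) t, I.choice_lt hm t.2.le⟩)
        (fun t => h.narr_one t t.2) h.narr_zero]
    · rw [(PMF.apply_eq_zero_iff _ _).2 hs, zero_mul, zero_mul]
  rw [tsum_congr hterm, ENNReal.tsum_mul_right, PMF.tsum_coe, one_mul]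

end SeqMatch

end

/-! ### The choice of the constants -/

theorem corollary1 :
    ∃ b : ℕ,
      -- approximation guarantee, for every sufficiently fine discretization and every tie-breaking
      (∀ (n m : ℕ) (I : SeqMatch.MNLUniform n m), 0 < m → (∀ i j, 1 ≤ I.v i j) →
        ∀ T : ℕ, b * (n + m + 1) ^ b ≤ T →
        ∀ y : ℕ → Fin n × Fin m → ℝ, SeqMatch.IsContinuousGreedyRun I.welfare T y →
          -- the unconstrained problem
          I.Achieves ((1 - Real.exp (-1)) / 2) Set.univ (SeqMatch.algorithmLaw (y T)) ∧
          -- the problem subject to cardinality constraints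
          ∀ K : Fin n → ℕ, (∀ i, 1 ≤ K i) →
            I.Achieves ((1 - Real.exp (-1)) / 2) (SeqMatch.cardFeasible K)
              (SeqMatch.algorithmLaw (y T))) ∧
      -- the algorithm runs in polynomial time
      ∃ (P : SeqMatch.Program) (c : ℕ),
        ∀ (n m : ℕ) (I : SeqMatch.MNLUniform n m), 0 < m → (∀ i j, 1 ≤ I.v i j) →
          (∀ s ∈ (P.exec I.input).support, s.time ≤ c * (n + m + 1) ^ c) ∧
          ∃ T : ℕ, b * (n + m + 1) ^ b ≤ T ∧
            ∃ y : ℕ → Fin n × Fin m → ℝ, SeqMatch.IsContinuousGreedyRun I.welfare T y ∧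
              ∀ S : SeqMatch.MenuProfile n m,
                ((P.exec I.input).map (SeqMatch.Memory.output n m)) S =
                  ENNReal.ofReal (SeqMatch.algorithmLaw (y T) S) := by
  obtain ⟨c, hc⟩ := SeqMatch.exists_polynomial_bound 200 12 4 12
  -- The exponent 12 is 5 + 7: five powers dominate n⁵, and since n + m + 1 ≥ 2 the other seven give
  -- a factor 2⁷, with 12 · 2⁷ = 1536 ≥ 1000.
  refine ⟨12, fun n m I hm hv T hT y hy => ?_,
    .seq (.continuousGreedy 12) .rounding, c, fun n m I hm _ => ⟨?_,
      12 * (n + m + 1) ^ 12, le_rfl, _, I.isContinuousGreedyRun_point hm _,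
      fun S => SeqMatch.map_output_program I hm (by norm_num) S⟩⟩
  · have hT0 : 0 < T := lt_of_lt_of_le (by positivity) hT
    have hT1 : 1000 * n ^ 5 ≤ T := by
      refine le_trans ?_ hT
      calc 1000 * n ^ 5 ≤ 12 * (2 ^ 7 * n ^ 5) := by omega
        _ ≤ 12 * ((n + m + 1) ^ 7 * (n + m + 1) ^ 5) := by
            gcongr
            · omega
            · omega
        _ = 12 * (n + m + 1) ^ 12 := by ring
    refine ⟨I.achieves_of_run hm hv hT0 hT1 hy _ fun _ => Set.mem_univ _, fun K hK =>
      I.achieves_of_run hm hv hT0 hT1 hy _ fun a i => ?_⟩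
    rw [SeqMatch.menusOf_partitionOf, Finset.card_singleton]
    exact hK i
  · intro s hs
    exact (SeqMatch.program_time_le I (by norm_num) s hs).trans (hc _ (by omega))
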